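/- For an integer $n\ge 2$ let $E_n$ be the edge set of the complete graph $K_n$ and let $\mathcal T_n$ be the set of spanning trees of $K_n$. A strategy on $n$ vertices is a map $\sigma: 2^{E_n}\times\mathcal T_n\to E_n$ with $\sigma(F,T)\in E(T)$ for all $F\subseteq E_n$ and $T\in\mathcal T_n$; let $\mathcal S_n$ be the set of these strategies. Let $T_1,T_2,\dots$ be independent, uniformly random elements of $\mathcal T_n$, let $G_{\sigma,0}$ be the empty graph on the $n$ vertices, and for $i\ge 1$ let $G_{\sigma,i}$ be obtained from $G_{\sigma,i-1}$ by adding the edge $\sigma(E(G_{\sigma,i-1}),T_i)$ (if it is not yet present). Let $\mathcal P_{HC}$ be the family of graphs on the $n$ vertices that contain a Hamiltonian cycle, and let $\tau(\sigma,\mathcal P_{HC})=\min\{i\ge 0: G_{\sigma,i}\in\mathcal P_{HC}\}$, which is $\infty$ if there is no such $i$. Theorem. Let $\omega=\omega(n)$ be any real-valued function with $\omega(n)\to\infty$ as $n\to\infty$. Then there are strategies $\sigma=\sigma_n\in\mathcal S_n$, $n\ge 2$, such that $$\mathbb P\left(\tau(\sigma_n,\mathcal P_{HC})\le n+\omega(n)\,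 n^{3/4}\right)\longrightarrow 1\qquad\text{as } n\to\infty .$$ -/

import Mathlib

open Filter Topology MeasureTheory

namespace USTSR

/-- Spanning trees of the complete graph on the vertex set `Fin n`. -/
abbrev SpanningTree (n : ℕ) : Type := {T : SimpleGraph (Fin n) // T.IsTree}

instance instMeasurableSpaceSpanningTree (n : ℕ) : MeasurableSpace (SpanningTree n) := ⊤

instance instDiscreteSpanningTree (n : ℕ) : DiscreteMeasurableSpace (SpanningTree n) :=
  ⟨fun _ => trivial⟩

instance instNonemptySpanningTree (n : ℕ) [NeZero n] : Nonempty (SpanningTree n) :=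
  ⟨⟨SimpleGraph.starGraph 0, SimpleGraph.isTree_starGraph 0⟩⟩

instance instNeZeroOfTwoLe (n : Set.Ici (2 : ℕ)) : NeZero (n : ℕ) :=
  ⟨by have h : 2 ≤ (n : ℕ) := n.2; omega⟩

/-- A strategy of Builder on `n` vertices: given the graph `F` built so far (that is, a set of
edges of the complete graph) and the spanning tree `T` offered in the current round, Builder
chooses an edge of `T`. -/
structure Strategy (n : ℕ) where
  choose : SimpleGraph (Fin n) → SpanningTree n → Sym2 (Fin n)
  choose_mem : ∀ (F : SimpleGraph (Fin n)) (T : SpanningTree n), choose F T ∈ T.1.edgeSet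

/-- The graph constructed after `i` rounds, when the tree offered in round `i + 1` is `T i`:
start from the empty graph and add the chosen edge in each round. -/
def graphAfter {n : ℕ} (σ : Strategy n) (T : ℕ → SpanningTree n) : ℕ → SimpleGraph (Fin n)
  | 0 => ⊥
  | i + 1 => graphAfter σ T i ⊔ SimpleGraph.fromEdgeSet {σ.choose (graphAfter σ T i) (T i)}

/-- The hitting time `min {i ≥ 0 : G_i ∈ P}` of a graph property `P`, equal to `⊤` if the
property is never attained. -/
noncomputable def hittingTime {n : ℕ} (σ : Strategy n) (P : Set (SimpleGraph (Fin n)))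
    (T : ℕ → SpanningTree n) : ℕ∞ :=
  ⨅ i ∈ {i : ℕ | graphAfter σ T i ∈ P}, (i : ℕ∞)

/-- The law of the sequence of offered trees: independent uniform spanning trees. -/
noncomputable def treeLaw (n : ℕ) [NeZero n] : Measure (ℕ → SpanningTree n) :=
  Measure.infinitePi fun _ : ℕ =>
    ProbabilityTheory.uniformOn (Set.univ : Set (SpanningTree n))

/-- The graphs on `n` vertices that contain a Hamiltonian cycle. -/
def hamiltonianCycleProperty (n : ℕ) : Set (SimpleGraph (Fin n)) :=
  {G | ∃ (v : Fin n) (p : G.Walk v v), p.IsHamiltonianCycle}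

end USTSR

/-!
The greedy strategy works. Call *deficiency* of a graph `F` the least number of edges that a
Hamiltonian cycle of the complete graph has outside `F`. It is at most `n` at the start and `0`
exactly when `F` is Hamiltonian. The strategy takes an edge of the offered tree that lowers the
deficiency, if there is one.

Everything about cycles rests on the 2-opt move (`exists_two_opt`): if a tour steps from `d` to `c`
and from `x` to `y`, these two steps may be replaced by `x d` and `y c`. It has two consequences.

* If the deficiency is `m`, there is a set `U` of `m` vertices such that every edge inside `U` lowers
  the deficiency (`exists_finset_deficiency_lt`). The tree has about `m ^ 2 / n` edges inside `U`,
  and the second moment bound `one_le_treeProb_mul_cliqueTime` shows that the expected time to lower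
  the deficiency is at most `1 + n / (m (m - 1)) + 12 / (m - 1)`. Lowering the deficiency from `n` to
  `M` thus takes time `n + O(n / M)`.
* Let `d c` be a missing step of a best tour, and call `y` a target of `c` if the edge `y c` would
  lower the deficiency. Joining `d` to `x` makes the successor of `x` a target of `c`, so a round
  produces a new target with probability at least one half as long as there are few of them
  (`IsEnd.exists_extend`, `half_le_treeProb_escape`). The *reach* of `F` is the largest number of
  targets of such an end `c`; the strategy raises it when it cannot lower the deficiency. Once there
  are `k` targets, a round hits one with probability at least `k / n` (`div_le_treeProb_star`). Thus
  each of the last `M` units of deficiency costs time `O(k + n / k)`.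

With `k` near `n ^ (1 / 2)` and `M` near `n ^ (1 / 4)` the expected time is `n + O(n ^ (3 / 4))`.
As a Hamiltonian graph has at least `n` edges, the time is never less than `n`, and Markov's
inequality applies to the excess. Deficiency and reach are functions of the current graph and are
monotone under adding useless edges, so the strategy needs no memory; the expected times are added
up in a potential function that falls by at least one per round on average
(`avg_potential_greedyStep_le`).

The second moment bounds need the joint probabilities of two edges in a uniform spanning tree. For
one edge, and for two disjoint edges, exchangeability and the number of edges suffice. For two
adjacent edges, an injective switching of trees gives the bound `4 / n ^ 2`
(`treeProb_adj_adj_le`).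
-/

namespace USTSR

/-! ### Tours, deficiency and the 2-opt move -/

section Tours

variable {V : Type*}

/-- The ordered pairs of consecutive vertices of the cyclic tour obtained from a walk `p` from `c`
to `d` by returning from `d` to `c`. -/
def tourPairs {c d : V} (p : (⊤ : SimpleGraph V).Walk c d) : List (V × V) :=
  (d, c) :: p.darts.map SimpleGraph.Dart.toProd

open Classical in
/-- The number of steps of the tour of `p` that are not edges of `F`. -/
noncomputable def cost (F : SimpleGraph V) {c d : V} (p : (⊤ : SimpleGraph V).Walk c d) : ℕ :=
  (tourPairs p).countP fun e => ¬ F.Adj e.1 e.2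

/-- The graph `F` with the edge `e` added (nothing is added if `e` is a loop). -/
def addEdge (F : SimpleGraph V) (e : Sym2 V) : SimpleGraph V :=
  F ⊔ SimpleGraph.fromEdgeSet {e}

lemma le_addEdge (F : SimpleGraph V) (e : Sym2 V) : F ≤ addEdge F e := le_sup_left

lemma addEdge_mono {F F' : SimpleGraph V} (h : F ≤ F') (e : Sym2 V) :
    addEdge F e ≤ addEdge F' e := sup_le_sup_right h _

lemma addEdge_adj (F : SimpleGraph V) {a b : V} (h : a ≠ b) : (addEdge F s(a, b)).Adj a b := by
  simp [addEdge, h]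

lemma countP_not_adj_anti {F F' : SimpleGraph V} (h : F ≤ F') (l : List (V × V))
    [DecidablePred fun e : V × V => ¬ F.Adj e.1 e.2]
    [DecidablePred fun e : V × V => ¬ F'.Adj e.1 e.2] :
    l.countP (fun e => ¬ F'.Adj e.1 e.2) ≤ l.countP (fun e => ¬ F.Adj e.1 e.2) := by
  refine List.countP_mono_left fun e _ he => ?_
  simp only [decide_eq_true_eq] at he ⊢
  exact fun hF => he (h hF)

lemma cost_anti {F F' : SimpleGraph V} (h : F ≤ F') {c d : V}
    (p : (⊤ : SimpleGraph V).Walk c d) : cost F' p ≤ cost F p := by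
  classical
  exact countP_not_adj_anti h _

lemma map_snd_tourPairs {c d : V} (p : (⊤ : SimpleGraph V).Walk c d) :
    (tourPairs p).map Prod.snd = p.support := by
  rw [← p.cons_map_snd_darts]
  simp [tourPairs, Function.comp_def]

lemma map_fst_tourPairs_perm {c d : V} (p : (⊤ : SimpleGraph V).Walk c d) :
    ((tourPairs p).map Prod.fst).Perm p.support := by
  rw [← p.map_fst_darts_append]
  simp only [tourPairs, List.map_cons, List.map_map]
  exact (List.perm_append_singleton _ _).symm

/-- A walk splits at each of its steps. -/
lemma exists_eq_append_cons {G : SimpleGraph V} {c d x y : V} (p : G.Walk c d)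
    (h : (x, y) ∈ p.darts.map SimpleGraph.Dart.toProd) :
    ∃ (A : G.Walk c x) (hxy : G.Adj x y) (B : G.Walk y d),
      p = A.append (SimpleGraph.Walk.cons hxy B) := by
  induction p with
  | nil => simp at h
  | @cons u v w huv p ih =>
    simp only [SimpleGraph.Walk.darts_cons, List.map_cons, List.mem_cons, Prod.mk.injEq] at h
    rcases h with ⟨rfl, rfl⟩ | h
    · exact ⟨.nil, huv, p, rfl⟩
    · obtain ⟨A, hxy, B, rfl⟩ := ih h
      exact ⟨.cons huv A, hxy, B, rfl⟩

variable [DecidableEq V]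

lemma isHamiltonian_of_perm {G G' : SimpleGraph V} {a b c d : V} {p : G.Walk a b}
    {q : G'.Walk c d} (hp : p.IsHamiltonian) (h : q.support.Perm p.support) :
    q.IsHamiltonian := fun v => by
  rw [h.count_eq]; exact hp v

lemma nodup_map_fst_tourPairs {c d : V} {p : (⊤ : SimpleGraph V).Walk c d}
    (hp : p.IsHamiltonian) : ((tourPairs p).map Prod.fst).Nodup :=
  (map_fst_tourPairs_perm p).nodup_iff.2 hp.isPath.support_nodup

lemma nodup_map_snd_tourPairs {c d : V} {p : (⊤ : SimpleGraph V).Walk c d}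
    (hp : p.IsHamiltonian) : ((tourPairs p).map Prod.snd).Nodup :=
  map_snd_tourPairs p ▸ hp.isPath.support_nodup

/-- Every step of a tour may be taken to be the closing one. -/
lemma exists_tourPairs_perm {c₀ d₀ c d : V} {p : (⊤ : SimpleGraph V).Walk c₀ d₀}
    (hp : p.IsHamiltonian) (hne : d₀ ≠ c₀) (h : (d, c) ∈ tourPairs p) :
    ∃ q : (⊤ : SimpleGraph V).Walk c d, q.IsHamiltonian ∧ (tourPairs q).Perm (tourPairs p) := by
  rcases List.mem_cons.1 h with h | h
  · cases h
    exact ⟨p, hp, List.Perm.refl _⟩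
  · obtain ⟨A, hdc, B, rfl⟩ := exists_eq_append_cons p h
    refine ⟨B.append (.cons (show (⊤ : SimpleGraph V).Adj d₀ c₀ from hne) A), ?_, ?_⟩
    · refine isHamiltonian_of_perm hp ?_
      simp only [SimpleGraph.Walk.support_append, SimpleGraph.Walk.support_cons, List.tail_cons]
      exact List.perm_append_comm
    · simp only [tourPairs, SimpleGraph.Walk.darts_append, SimpleGraph.Walk.darts_cons,
        List.map_append, List.map_cons]
      rw [← List.cons_append, ← List.cons_append]
      refine List.perm_append_comm.trans ?_
      simp only [List.cons_append]
      refine List.Perm.cons _ ?_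
      exact List.Perm.refl _

open Classical in
/-- The 2-opt move: the steps `(x, y)` and `(d, c)` of a tour are replaced by `(x, d)` and
`(y, c)`, the part of the tour from `y` to `d` being reversed. Here `R F` counts the unchanged
steps that are missing in `F`. -/
lemma exists_two_opt {c d x y : V} {p : (⊤ : SimpleGraph V).Walk c d} (hp : p.IsHamiltonian)
    (h : (x, y) ∈ p.darts.map SimpleGraph.Dart.toProd) (hxd : x ≠ d) :
    ∃ (q : (⊤ : SimpleGraph V).Walk c y) (R : SimpleGraph V → ℕ), q.IsHamiltonian ∧ Antitone R ∧
      ∀ F : SimpleGraph V,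
        cost F p = R F + (if F.Adj x y then 0 else 1) + (if F.Adj d c then 0 else 1) ∧
        cost F q = R F + (if F.Adj x d then 0 else 1) + (if F.Adj y c then 0 else 1) := by
  obtain ⟨A, hxy, B, rfl⟩ := exists_eq_append_cons p h
  refine ⟨A.append (.cons (show (⊤ : SimpleGraph V).Adj x d from hxd) B.reverse),
    fun F => (A.darts.map SimpleGraph.Dart.toProd).countP (fun e => ¬ F.Adj e.1 e.2) +
      (B.darts.map SimpleGraph.Dart.toProd).countP (fun e => ¬ F.Adj e.1 e.2), ?_, ?_, ?_⟩
  · refine isHamiltonian_of_perm hp ?_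
    simp only [SimpleGraph.Walk.support_append, SimpleGraph.Walk.support_cons, List.tail_cons,
      SimpleGraph.Walk.support_reverse]
    exact List.Perm.append_left _ (List.reverse_perm _)
  · intro F F' hF
    exact add_le_add (countP_not_adj_anti hF _) (countP_not_adj_anti hF _)
  · intro F
    have hB : (B.reverse.darts.map SimpleGraph.Dart.toProd).countP (fun e => ¬ F.Adj e.1 e.2) =
        (B.darts.map SimpleGraph.Dart.toProd).countP (fun e => ¬ F.Adj e.1 e.2) := by
      simp only [SimpleGraph.Walk.darts_reverse, List.map_reverse, List.countP_reverse,
        List.map_map, List.countP_map]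
      refine List.countP_congr fun e _ => ?_
      simp [F.adj_comm]
    constructor
    · simp only [cost, tourPairs, SimpleGraph.Walk.darts_append, SimpleGraph.Walk.darts_cons,
        List.map_append, List.map_cons, List.countP_cons, List.countP_append]
      by_cases h1 : F.Adj x y <;> by_cases h2 : F.Adj d c <;> simp [h1, h2] <;> omega
    · simp only [cost, tourPairs, SimpleGraph.Walk.darts_append, SimpleGraph.Walk.darts_cons,
        List.map_append, List.map_cons, List.countP_cons, List.countP_append, hB]
      by_cases h1 : F.Adj x d <;> by_cases h2 : F.Adj y c <;> simp [h1, h2] <;> omega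

/-- The least number of edges that a Hamiltonian cycle of the complete graph has outside `F`. -/
noncomputable def deficiency (F : SimpleGraph V) : ℕ :=
  sInf {k | ∃ (c d : V) (p : (⊤ : SimpleGraph V).Walk c d), p.IsHamiltonian ∧ cost F p = k}

lemma deficiency_le_cost (F : SimpleGraph V) {c d : V} {p : (⊤ : SimpleGraph V).Walk c d}
    (hp : p.IsHamiltonian) : deficiency F ≤ cost F p :=
  Nat.sInf_le ⟨c, d, p, hp, rfl⟩

/-- A vertex `c` is an end for `F` if some tour of least cost has a step into `c` that is not an
edge of `F`. -/
def IsEnd (F : SimpleGraph V) (c : V) : Prop :=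
  ∃ (d : V) (p : (⊤ : SimpleGraph V).Walk c d),
    p.IsHamiltonian ∧ cost F p = deficiency F ∧ ¬ F.Adj d c

lemma IsEnd.mono {F F' : SimpleGraph V} (hF : F ≤ F')
    (hd : deficiency F' = deficiency F) {c : V} (h : IsEnd F c) : IsEnd F' c := by
  classical
  obtain ⟨d, p, hp, hc, hdc⟩ := h
  have h1 := cost_anti hF p
  have h2 := deficiency_le_cost F' hp
  refine ⟨d, p, hp, by omega, fun hadj => ?_⟩
  have h3 : cost F' p < cost F p := by
    have h4 := countP_not_adj_anti hF (p.darts.map SimpleGraph.Dart.toProd)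
    simp only [cost, tourPairs, List.countP_cons]
    simp [hdc, hadj]
    simpa [Function.comp_def] using h4
  omega

variable [Fintype V]

lemma exists_isHamiltonian_top [Nonempty V] :
    ∃ (c d : V) (p : (⊤ : SimpleGraph V).Walk c d), p.IsHamiltonian := by
  have hne : (Finset.univ : Finset V).toList ≠ [] := by
    simpa using (Finset.univ_nonempty (α := V)).ne_empty
  have hch : (Finset.univ : Finset V).toList.IsChain (⊤ : SimpleGraph V).Adj :=
    ((Finset.nodup_toList (Finset.univ : Finset V)).isChain)
  refine ⟨_, _, SimpleGraph.Walk.ofSupport _ hne hch, fun v => ?_⟩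
  rw [SimpleGraph.Walk.support_ofSupport]
  exact List.count_eq_one_of_mem (Finset.nodup_toList _) (by simp)

lemma exists_cost_eq_deficiency [Nonempty V] (F : SimpleGraph V) :
    ∃ (c d : V) (p : (⊤ : SimpleGraph V).Walk c d), p.IsHamiltonian ∧ cost F p = deficiency F := by
  obtain ⟨c, d, p, hp⟩ := exists_isHamiltonian_top (V := V)
  exact Nat.sInf_mem (s := {k | ∃ (c d : V) (p : (⊤ : SimpleGraph V).Walk c d),
    p.IsHamiltonian ∧ cost F p = k}) ⟨_, c, d, p, hp, rfl⟩

lemma deficiency_anti [Nonempty V] {F F' : SimpleGraph V} (h : F ≤ F') :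
    deficiency F' ≤ deficiency F := by
  obtain ⟨c, d, p, hp, hc⟩ := exists_cost_eq_deficiency F
  exact hc ▸ (deficiency_le_cost F' hp).trans (cost_anti h p)

lemma length_tourPairs {c d : V} {p : (⊤ : SimpleGraph V).Walk c d} (hp : p.IsHamiltonian) :
    (tourPairs p).length = Fintype.card V := by
  rw [← hp.length_support, ← map_snd_tourPairs, List.length_map]

lemma deficiency_le_card [Nonempty V] (F : SimpleGraph V) : deficiency F ≤ Fintype.card V := by
  obtain ⟨c, d, p, hp⟩ := exists_isHamiltonian_top (V := V)
  exact (deficiency_le_cost F hp).trans (List.countP_le_length.trans (length_tourPairs hp).le)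

lemma ne_of_isHamiltonian [Nontrivial V] {c d : V} {p : (⊤ : SimpleGraph V).Walk c d}
    (hp : p.IsHamiltonian) : d ≠ c := by
  rintro rfl
  have h1 := hp.length_eq
  have h2 := SimpleGraph.Walk.length_eq_zero_iff.2 (SimpleGraph.Walk.isPath_iff_nil.1 hp.isPath)
  have := Fintype.one_lt_card (α := V)
  omega

/-- A graph of deficiency zero on at least three vertices has a Hamiltonian cycle. -/
lemma exists_isHamiltonianCycle (h3 : 3 ≤ Fintype.card V) {F : SimpleGraph V}
    (h : deficiency F = 0) : ∃ (v : V) (p : F.Walk v v), p.IsHamiltonianCycle := by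
  have : Nontrivial V := Fintype.one_lt_card_iff_nontrivial.1 (by omega)
  obtain ⟨c, d, p, hp, hc⟩ := exists_cost_eq_deficiency F
  rw [h, cost, List.countP_eq_zero] at hc
  simp only [tourPairs, List.mem_cons, forall_eq_or_imp, decide_eq_true_eq, not_not] at hc
  have hF : ∀ e ∈ p.edges, e ∈ F.edgeSet := by
    intro e he
    obtain ⟨a, ha, rfl⟩ := List.mem_map.1 he
    exact hc.2 _ (List.mem_map.2 ⟨a, ha, rfl⟩)
  have hq : (p.transfer F hF).IsHamiltonian :=
    isHamiltonian_of_perm hp (by rw [SimpleGraph.Walk.support_transfer])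
  have hlen := hp.length_eq
  refine ⟨d, .cons hc.1 (p.transfer F hF), ?_, isHamiltonian_of_perm hq (by simp)⟩
  rw [SimpleGraph.Walk.cons_isCycle_iff]
  refine ⟨hq.isPath, ?_⟩
  intro he
  rw [SimpleGraph.Walk.edges_transfer] at he
  -- on a path, an edge between the two ends would be the whole path
  have := hp.isPath.length_eq_one_of_mem_edges (by rwa [Sym2.eq_swap] at he)
  omega

open Classical in
/-- The vertices whose connection to `c` would lower the deficiency. -/
noncomputable def targets (F : SimpleGraph V) (c : V) : Finset V :=
  {y | deficiency (addEdge F s(y, c)) < deficiency F}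

open Classical in
/-- The largest number of targets of an end. -/
noncomputable def reach (F : SimpleGraph V) : ℕ :=
  (Finset.univ.filter (IsEnd F)).sup fun c => (targets F c).card

lemma mem_targets {F : SimpleGraph V} {c y : V} :
    y ∈ targets F c ↔ deficiency (addEdge F s(y, c)) < deficiency F := by
  simp [targets]

lemma card_targets_le_reach {F : SimpleGraph V} {c : V} (h : IsEnd F c) :
    (targets F c).card ≤ reach F := by
  classical
  exact Finset.le_sup (f := fun c => (targets F c).card) (by simpa using h)

lemma exists_isEnd [Nontrivial V] {F : SimpleGraph V} (h : deficiency F ≠ 0) :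
    ∃ c, IsEnd F c := by
  obtain ⟨c₀, d₀, p, hp, hc⟩ := exists_cost_eq_deficiency F
  have hpos : 0 < cost F p := by omega
  rw [cost, List.countP_pos_iff] at hpos
  obtain ⟨⟨d, c⟩, hmem, hF⟩ := hpos
  obtain ⟨q, hq, hperm⟩ := exists_tourPairs_perm hp (ne_of_isHamiltonian hp) hmem
  exact ⟨c, d, q, hq, by rw [← hc, cost, cost, hperm.countP_eq], by simpa using hF⟩

lemma exists_isEnd_card_targets [Nontrivial V] {F : SimpleGraph V} (h : deficiency F ≠ 0) :
    ∃ c, IsEnd F c ∧ (targets F c).card = reach F := by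
  classical
  obtain ⟨c, hc⟩ := exists_isEnd h
  obtain ⟨c', hc', hs⟩ := Finset.exists_mem_eq_sup (Finset.univ.filter (IsEnd F))
    ⟨c, by simpa using hc⟩ (fun c => (targets F c).card)
  exact ⟨c', by simpa using hc', hs.symm⟩

lemma targets_mono [Nonempty V] {F F' : SimpleGraph V} (hF : F ≤ F')
    (hd : deficiency F' = deficiency F) (c : V) : targets F c ⊆ targets F' c := by
  intro y hy
  rw [mem_targets] at hy ⊢
  rw [hd]
  exact (deficiency_anti (addEdge_mono hF _)).trans_lt hy

lemma reach_mono [Nonempty V] {F F' : SimpleGraph V} (hF : F ≤ F')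
    (hd : deficiency F' = deficiency F) : reach F ≤ reach F' := by
  classical
  refine Finset.sup_le fun c hc => ?_
  exact (Finset.card_le_card (targets_mono hF hd c)).trans
    (card_targets_le_reach ((by simpa using hc : IsEnd F c).mono hF hd))

/-- The tails of the missing steps of an optimal tour: any edge between two of them allows a 2-opt
move that removes two missing steps and creates at most one. -/
lemma exists_finset_deficiency_lt [Nontrivial V] (F : SimpleGraph V) :
    ∃ U : Finset V, U.card = deficiency F ∧
      ∀ a ∈ U, ∀ b ∈ U, a ≠ b → deficiency (addEdge F s(a, b)) < deficiency F := by
  classical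
  obtain ⟨c₀, d₀, p, hp, hc⟩ := exists_cost_eq_deficiency F
  set l := (tourPairs p).filter fun e => ¬ F.Adj e.1 e.2 with hl
  have hnd : (l.map Prod.fst).Nodup :=
    (nodup_map_fst_tourPairs hp).sublist (List.filter_sublist.map _)
  refine ⟨(l.map Prod.fst).toFinset, ?_, ?_⟩
  · rw [List.toFinset_card_of_nodup hnd, List.length_map, ← hc, cost, List.countP_eq_length_filter]
  · intro x hx d hd hne
    simp only [List.mem_toFinset, List.mem_map, hl, List.mem_filter, decide_eq_true_eq,
      Prod.exists, exists_and_right, exists_eq_right] at hx hd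
    obtain ⟨y, hxy, hFxy⟩ := hx
    obtain ⟨c, hdc, hFdc⟩ := hd
    obtain ⟨q, hq, hperm⟩ := exists_tourPairs_perm hp (ne_of_isHamiltonian hp) hdc
    have hcq : cost F q = deficiency F := by rw [← hc, cost, cost, hperm.countP_eq]
    have hxy' : (x, y) ∈ q.darts.map SimpleGraph.Dart.toProd := by
      rcases List.mem_cons.1 (hperm.mem_iff.2 hxy) with h | h
      · exact absurd (congrArg Prod.fst h) hne
      · exact h
    obtain ⟨r, R, hr, hR, hcost⟩ := exists_two_opt hq hxy' hne
    have h1 := (hcost F).1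
    have h2 := (hcost (addEdge F s(x, d))).2
    have h3 := hR (le_addEdge F s(x, d))
    have h4 := deficiency_le_cost (addEdge F s(x, d)) hr
    simp only [hFxy, hFdc, if_false, addEdge_adj F hne, if_true] at h1 h2
    split_ifs at h2 <;> omega

/-- For an end `c` there is a vertex `d` such that joining `d` to almost any vertex lowers the
deficiency or creates a new target of `c`: by a 2-opt move, if `d` is joined to `x`, then the
successor of `x` on the tour becomes a target. -/
lemma IsEnd.exists_extend [Nontrivial V] {F : SimpleGraph V} {c : V} (h : IsEnd F c) :
    ∃ (d : V) (B : Finset V), B.card ≤ (targets F c).card ∧ ∀ x ∉ B, x ≠ d →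
      deficiency (addEdge F s(x, d)) < deficiency F ∨
        (deficiency (addEdge F s(x, d)) = deficiency F ∧
          (targets F c).card < reach (addEdge F s(x, d))) := by
  classical
  have hend := h
  obtain ⟨d, p, hp, hc, hdc⟩ := h
  have hinj : ∀ e ∈ tourPairs p, ∀ e' ∈ tourPairs p, e.2 = e'.2 → e = e' := fun e he e' he' =>
    List.inj_on_of_nodup_map (nodup_map_snd_tourPairs hp) he he'
  refine ⟨d, ((tourPairs p).toFinset.filter fun e => e.2 ∈ targets F c).image Prod.fst, ?_, ?_⟩
  · refine Finset.card_image_le.trans ?_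
    refine Finset.card_le_card_of_injOn Prod.snd (fun e he => ?_) (fun e he e' he' => ?_)
    · simp only [Finset.coe_filter, Set.mem_ofPred_eq] at he
      exact he.2
    · simp only [Finset.coe_filter, Set.mem_ofPred_eq, List.mem_toFinset] at he he'
      exact hinj e he.1 e' he'.1
  · intro x hx hxd
    obtain ⟨⟨x', y⟩, hxy, rfl⟩ : ∃ e ∈ tourPairs p, e.1 = x := by
      have := (map_fst_tourPairs_perm p).mem_iff.2 (hp.mem_support x)
      simpa using this
    have hy : y ∉ targets F c := by
      intro hy
      exact hx (Finset.mem_image.2 ⟨(x', y), by simp [hxy, hy], rfl⟩)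
    simp only at hxd hx ⊢
    have hyc : y ≠ c := by
      rintro rfl
      exact hxd (congrArg Prod.fst (hinj (x', y) hxy (d, y) (by simp [tourPairs]) rfl))
    have hxy' : (x', y) ∈ p.darts.map SimpleGraph.Dart.toProd := by
      rcases List.mem_cons.1 hxy with h | h
      · exact absurd (congrArg Prod.fst h) hxd
      · exact h
    obtain ⟨q, R, hq, hR, hcost⟩ := exists_two_opt hp hxy' hxd
    set F' := addEdge F s(x', d) with hF'
    have hle : F ≤ F' := le_addEdge _ _
    have h1 := (hcost F).1
    have h2 := (hcost (addEdge F' s(y, c))).2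
    have h3 := hR (hle.trans (le_addEdge F' s(y, c)))
    have h4 := deficiency_le_cost (addEdge F' s(y, c)) hq
    have h5 : (addEdge F' s(y, c)).Adj x' d := le_addEdge _ _ (addEdge_adj F hxd)
    simp only [hdc, if_false, h5, addEdge_adj F' hyc, if_true] at h1 h2
    rcases (deficiency_anti hle).lt_or_eq with hlt | heq
    · exact Or.inl hlt
    · refine Or.inr ⟨heq, ?_⟩
      have hy' : y ∈ targets F' c := by rw [mem_targets]; omega
      refine lt_of_lt_of_le (Finset.card_lt_card ?_) (card_targets_le_reach (hend.mono hle heq))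
      exact ⟨targets_mono hle heq c, fun hsub => hy (hsub hy')⟩

end Tours

/-! ### Edges of the uniform spanning tree -/

section Trees

noncomputable instance instFintypeSpanningTree (n : ℕ) : Fintype (SpanningTree n) :=
  Fintype.ofFinite _

variable {n : ℕ}

open Classical in
/-- The probability that a uniformly random spanning tree of the complete graph satisfies `P`. -/
noncomputable def treeProb (P : SpanningTree n → Prop) : ℝ :=
  ((Finset.univ.filter P).card : ℝ) / Fintype.card (SpanningTree n)

lemma card_spanningTree_pos [NeZero n] : (0 : ℝ) < Fintype.card (SpanningTree n) := by
  exact_mod_cast Fintype.card_pos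

lemma treeProb_mono {P Q : SpanningTree n → Prop} (h : ∀ T, P T → Q T) :
    treeProb P ≤ treeProb Q := by
  classical
  exact div_le_div_of_nonneg_right (Nat.cast_le.2 (Finset.card_le_card
    (Finset.monotone_filter_right _ fun T _ => h T))) (Nat.cast_nonneg _)

lemma treeProb_nonneg (P : SpanningTree n → Prop) : 0 ≤ treeProb P := by
  unfold treeProb; positivity

open Classical in
lemma treeProb_eq_sum (P : SpanningTree n → Prop) :
    treeProb P = (∑ T : SpanningTree n, if P T then (1 : ℝ) else 0) /
      Fintype.card (SpanningTree n) := by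
  simp [treeProb]

/-- The spanning trees relabelled by a permutation of the vertices. -/
def relabel (σ : Equiv.Perm (Fin n)) : SpanningTree n ≃ SpanningTree n where
  toFun T := ⟨T.1.comap σ, (SimpleGraph.Iso.comap σ T.1).isTree_iff.2 T.2⟩
  invFun T := ⟨T.1.comap σ.symm, (SimpleGraph.Iso.comap σ.symm T.1).isTree_iff.2 T.2⟩
  left_inv T := by ext; simp
  right_inv T := by ext; simp

lemma treeProb_comp_relabel (σ : Equiv.Perm (Fin n)) (P : SpanningTree n → Prop) :
    treeProb (fun T => P (relabel σ T)) = treeProb P := by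
  classical
  rw [treeProb_eq_sum, treeProb_eq_sum]
  congr 1
  exact Equiv.sum_comp (relabel σ) fun T => if P T then (1 : ℝ) else 0

/-- The uniform spanning tree is exchangeable: the probability that it contains given edges depends
only on the pattern these edges form. -/
lemma treeProb_eq_of_injective {k : ℕ} {f g : Fin k → Fin n} (hf : Function.Injective f)
    (hg : Function.Injective g) (Q : (Fin k → Fin k → Prop) → Prop) :
    treeProb (fun T : SpanningTree n => Q fun i j => T.1.Adj (f i) (f j)) =
      treeProb (fun T : SpanningTree n => Q fun i j => T.1.Adj (g i) (g j)) := by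
  obtain ⟨σ, hσ⟩ := Equiv.Perm.exists_extending_pair f g hf hg
  rw [← treeProb_comp_relabel σ]
  simp only [relabel, Equiv.coe_fn_mk, SimpleGraph.comap_adj, hσ]

/-- Double counting: averaging over all placements of a pattern on `k` vertices. -/
lemma descFactorial_mul_treeProb_le [NeZero n] {k : ℕ} {f : Fin k → Fin n}
    (hf : Function.Injective f) (Q : (Fin k → Fin k → Prop) → Prop) {C : ℕ}
    (hC : ∀ T : SpanningTree n,
      Nat.card {g : Fin k ↪ Fin n // Q fun i j => T.1.Adj (g i) (g j)} ≤ C) :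
    (n.descFactorial k : ℝ) * treeProb (fun T : SpanningTree n =>
      Q fun i j => T.1.Adj (f i) (f j)) ≤ C := by
  classical
  have hN := card_spanningTree_pos (n := n)
  have h1 : ∑ g : Fin k ↪ Fin n, treeProb (fun T : SpanningTree n =>
      Q fun i j => T.1.Adj (g i) (g j)) = (n.descFactorial k : ℝ) *
      treeProb (fun T : SpanningTree n => Q fun i j => T.1.Adj (f i) (f j)) := by
    rw [Finset.sum_congr rfl fun g _ => treeProb_eq_of_injective g.injective hf Q]
    simp [Fintype.card_embedding_eq]
  rw [← h1]
  simp only [treeProb_eq_sum]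
  rw [← Finset.sum_div, Finset.sum_comm, div_le_iff₀ hN]
  calc ∑ T : SpanningTree n, ∑ g : Fin k ↪ Fin n,
        (if Q fun i j => T.1.Adj (g i) (g j) then (1 : ℝ) else 0)
      ≤ ∑ _T : SpanningTree n, (C : ℝ) := by
        refine Finset.sum_le_sum fun T _ => ?_
        have := hC T
        rw [Nat.card_eq_fintype_card, Fintype.card_subtype] at this
        rw [Finset.sum_boole]
        exact_mod_cast this
    _ = C * Fintype.card (SpanningTree n) := by simp [mul_comm]

open Classical in
lemma card_adj_pairs (T : SpanningTree n) :
    (Finset.univ.filter fun e : Fin n × Fin n => T.1.Adj e.1 e.2).card = 2 * (n - 1) := by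
  have h1 : (Finset.univ.filter fun e : Fin n × Fin n => T.1.Adj e.1 e.2).card =
      ∑ v, T.1.degree v := by
    rw [Finset.card_filter, Fintype.sum_prod_type]
    refine Finset.sum_congr rfl fun v _ => ?_
    rw [← Finset.card_filter, ← SimpleGraph.card_neighborFinset_eq_degree]
    congr 1
    ext w
    simp
  have h2 := T.2.card_edgeFinset
  rw [Fintype.card_fin] at h2
  rw [h1, T.1.sum_degrees_eq_twice_card_edges]
  omega

/-- Every edge is in the uniform spanning tree with probability `2 / n`. -/
lemma treeProb_adj (hn : 2 ≤ n) {a b : Fin n} (hab : a ≠ b) :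
    treeProb (fun T : SpanningTree n => T.1.Adj a b) = 2 / n := by
  classical
  have : NeZero n := ⟨by omega⟩
  have hN := card_spanningTree_pos (n := n)
  have h1 : ∑ e ∈ (Finset.univ : Finset (Fin n)).offDiag,
      treeProb (fun T : SpanningTree n => T.1.Adj e.1 e.2) =
      (n * (n - 1 : ℕ) : ℝ) * treeProb (fun T : SpanningTree n => T.1.Adj a b) := by
    rw [Finset.sum_congr rfl (g := fun _ => treeProb (fun T : SpanningTree n => T.1.Adj a b)),
      Finset.sum_const, Finset.offDiag_card]
    · simp [Nat.mul_sub, ← Nat.cast_mul]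
    · rintro ⟨x, y⟩ hxy
      have hxy' : x ≠ y := by simpa using hxy
      have := treeProb_eq_of_injective (n := n) (k := 2) (f := ![x, y]) (g := ![a, b])
        (by intro i j; fin_cases i <;> fin_cases j <;> simp [hxy', hxy'.symm])
        (by intro i j; fin_cases i <;> fin_cases j <;> simp [hab, hab.symm]) (fun A => A 0 1)
      simpa using this
  have h2 : ∑ e ∈ (Finset.univ : Finset (Fin n)).offDiag,
      treeProb (fun T : SpanningTree n => T.1.Adj e.1 e.2) = 2 * (n - 1 : ℕ) := by
    simp only [treeProb_eq_sum]
    rw [← Finset.sum_div, Finset.sum_comm, div_eq_iff hN.ne']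
    rw [Finset.sum_congr rfl (g := fun _ => (2 * (n - 1 : ℕ) : ℝ))]
    · simp [mul_comm]
    · intro T _
      rw [Finset.sum_boole, ← Nat.cast_ofNat, ← Nat.cast_mul, ← card_adj_pairs T]
      congr 2
      ext ⟨x, y⟩
      simpa using fun h => SimpleGraph.Adj.ne h
  have hn1 : (0 : ℝ) < (n - 1 : ℕ) := by exact_mod_cast (by omega : 0 < n - 1)
  have hn0 : (0 : ℝ) < n := by exact_mod_cast (by omega : 0 < n)
  rw [h2] at h1
  rw [eq_div_iff hn0.ne']
  apply mul_right_cancel₀ hn1.ne'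
  linarith

/-- Two disjoint edges: negative correlation up to a factor `1 + O(1 / n)`. -/
lemma treeProb_adj_disjoint_le [NeZero n] {a b c d : Fin n} (hab : a ≠ b) (hac : a ≠ c)
    (had : a ≠ d) (hbc : b ≠ c) (hbd : b ≠ d) (hcd : c ≠ d) :
    (n.descFactorial 4 : ℝ) * treeProb (fun T : SpanningTree n => T.1.Adj a b ∧ T.1.Adj c d) ≤
      ((2 * (n - 1)) ^ 2 : ℕ) := by
  classical
  have hinj : Function.Injective ![a, b, c, d] := by
    intro i j
    fin_cases i <;> fin_cases j <;>
      simp [hab, hac, had, hbc, hbd, hcd, hab.symm, hac.symm, had.symm, hbc.symm, hbd.symm,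
        hcd.symm]
  have := descFactorial_mul_treeProb_le hinj (fun A => A 0 1 ∧ A 2 3)
    (C := (2 * (n - 1)) ^ 2) ?_
  · simpa using this
  · intro T
    rw [pow_two, ← card_adj_pairs T, ← Finset.card_product, Nat.card_eq_fintype_card,
      Fintype.card_subtype]
    refine Finset.card_le_card_of_injOn (fun g => ((g 0, g 1), (g 2, g 3))) ?_ ?_
    · intro g hg
      simpa using hg
    · intro g _ g' _ h
      simp only [Prod.mk.injEq] at h
      ext i
      fin_cases i <;> simp [h.1.1, h.1.2, h.2.1, h.2.2]

end Trees

/-! ### Switching of trees and correlation of edges -/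

section Switching

variable {V : Type*}

/-- A property preserved by all edges propagates along connected components. -/
lemma reachable_induction {G : SimpleGraph V} {P : V → Prop} (hstep : ∀ a b, G.Adj a b → P a → P b)
    {x y : V} (h : G.Reachable x y) (hx : P x) : P y := by
  obtain ⟨p⟩ := h
  induction p with
  | nil => exact hx
  | cons hab _ ih => exact ih (hstep _ _ hab hx)

lemma not_reachable_deleteEdges {T : SimpleGraph V} (hT : T.IsTree) {u w : V} (h : T.Adj u w) :
    ¬ (T.deleteEdges {s(u, w)}).Reachable u w :=
  SimpleGraph.isAcyclic_iff_forall_adj_isBridge.1 hT.isAcyclic h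

lemma reachable_or_reachable_deleteEdges {T : SimpleGraph V} (hT : T.IsTree) (u w x : V) :
    (T.deleteEdges {s(u, w)}).Reachable u x ∨ (T.deleteEdges {s(u, w)}).Reachable w x := by
  refine reachable_induction (G := T) (x := u) (P := fun y =>
    (T.deleteEdges {s(u, w)}).Reachable u y ∨ (T.deleteEdges {s(u, w)}).Reachable w y)
    (fun a b hab ha => ?_) (hT.connected u x) (Or.inl .rfl)
  by_cases he : s(a, b) = s(u, w)
  · rcases Sym2.eq_iff.1 he with ⟨rfl, rfl⟩ | ⟨rfl, rfl⟩
    · exact Or.inr .rfl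
    · exact Or.inl .rfl
  · have hadj : (T.deleteEdges {s(u, w)}).Adj a b := by simp [hab, he]
    exact ha.imp (·.trans hadj.reachable) (·.trans hadj.reachable)

/-- Replacing the edge `u w` of a tree by an edge from `w` to the component of `u`. -/
lemma isTree_switch {T : SimpleGraph V} (hT : T.IsTree) {u w z : V} (h : T.Adj u w)
    (hz : (T.deleteEdges {s(u, w)}).Reachable u z) :
    (T.deleteEdges {s(u, w)} ⊔ SimpleGraph.edge w z).IsTree := by
  have hnr := not_reachable_deleteEdges hT h
  have hwz : ¬ (T.deleteEdges {s(u, w)}).Reachable w z := fun h' => hnr (hz.trans h'.symm)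
  have hne : w ≠ z := by rintro rfl; exact hwz .rfl
  have : Nonempty V := ⟨u⟩
  refine ⟨⟨?_⟩, (hT.isAcyclic.anti (T.deleteEdges_le _)).sup_edge_of_not_reachable hwz⟩
  · have hle : T.deleteEdges {s(u, w)} ≤ T.deleteEdges {s(u, w)} ⊔ SimpleGraph.edge w z :=
      le_sup_left
    have hadj : (T.deleteEdges {s(u, w)} ⊔ SimpleGraph.edge w z).Adj w z := by
      simp [SimpleGraph.edge_adj, hne]
    have key : ∀ x, (T.deleteEdges {s(u, w)} ⊔ SimpleGraph.edge w z).Reachable u x := by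
      intro x
      rcases reachable_or_reachable_deleteEdges hT u w x with hx | hx
      · exact hx.mono hle
      · exact ((hz.mono hle).trans hadj.symm.reachable).trans (hx.mono hle)
    exact fun x y => (key x).symm.trans (key y)

/-- In a switched tree, the new neighbour of `w` is the only one on the side of `u`. -/
lemma eq_of_sup_edge_eq {D₁ D₂ : SimpleGraph V} {u w z₁ z₂ : V}
    (h : D₁ ⊔ SimpleGraph.edge w z₁ = D₂ ⊔ SimpleGraph.edge w z₂)
    (hw₁ : ¬ D₁.Reachable u w) (hw₂ : ¬ D₂.Reachable u w) (hz₁ : D₁.Reachable u z₁) :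
    z₁ = z₂ := by
  by_contra hne
  have hwz : w ≠ z₁ := by rintro rfl; exact hw₁ hz₁
  have key : D₁.Reachable u z₁ ∧ D₂.Reachable u z₁ := by
    refine reachable_induction (P := fun x => D₁.Reachable u x ∧ D₂.Reachable u x) (G := D₁)
      (fun a b hab ha => ?_) hz₁ ⟨.rfl, .rfl⟩
    have hb : D₁.Reachable u b := ha.1.trans hab.reachable
    refine ⟨hb, ha.2.trans (SimpleGraph.Adj.reachable ?_)⟩
    have h' : (D₂ ⊔ SimpleGraph.edge w z₂).Adj a b := by rw [← h]; exact Or.inl hab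
    rcases h' with h' | h'
    · exact h'
    · rw [SimpleGraph.edge_adj] at h'
      rcases h'.1 with ⟨rfl, -⟩ | ⟨-, rfl⟩
      · exact absurd ha.1 hw₁
      · exact absurd hb hw₁
  have h' : (D₂ ⊔ SimpleGraph.edge w z₂).Adj w z₁ := by
    rw [← h]; exact Or.inr (by simp [SimpleGraph.edge_adj, hwz])
  rcases h' with h' | h'
  · exact hw₂ (key.2.trans h'.symm.reachable)
  · rw [SimpleGraph.edge_adj] at h'
    rcases h'.1 with ⟨-, h'⟩ | ⟨rfl, rfl⟩
    · exact hne h'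
    · exact hwz rfl

lemma le_of_sup_edge_eq {D₁ D₂ : SimpleGraph V} {u w z : V}
    (h : D₁ ⊔ SimpleGraph.edge w z = D₂ ⊔ SimpleGraph.edge w z)
    (hw₁ : ¬ D₁.Reachable u w) (hz₁ : D₁.Reachable u z) : D₁ ≤ D₂ := by
  intro a b hab
  have h' : (D₂ ⊔ SimpleGraph.edge w z).Adj a b := by rw [← h]; exact Or.inl hab
  rcases h' with h' | h'
  · exact h'
  · rw [SimpleGraph.edge_adj] at h'
    rcases h'.1 with ⟨rfl, rfl⟩ | ⟨rfl, rfl⟩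
    · exact absurd (hz₁.trans hab.symm.reachable) hw₁
    · exact absurd (hz₁.trans hab.reachable) hw₁

lemma deleteEdges_sup_edge {T : SimpleGraph V} {u w : V} (h : T.Adj u w) :
    T.deleteEdges {s(u, w)} ⊔ SimpleGraph.edge u w = T := by
  ext a b
  simp only [SimpleGraph.sup_adj, SimpleGraph.deleteEdges_adj, SimpleGraph.edge_adj,
    Set.mem_singleton_iff, Sym2.eq_iff]
  constructor
  · rintro (h' | ⟨⟨rfl, rfl⟩ | ⟨rfl, rfl⟩, -⟩)
    · exact h'.1
    · exact h
    · exact h.symm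
  · intro h'
    have := h'.ne
    tauto

end Switching

section Correlation

variable {n : ℕ}

open Classical in
/-- Switching is injective: a tree with the edges `u v`, `u w`, together with a vertex `z` on the
side of `u` after removal of `u w`, is determined by the tree in which `u w` is replaced by
`w z`. -/
lemma sum_card_side_le {u v w : Fin n} (hvw : v ≠ w) :
    ∑ T ∈ Finset.univ.filter (fun T : SpanningTree n => T.1.Adj u v ∧ T.1.Adj u w),
      (Finset.univ.filter fun z => (T.1.deleteEdges {s(u, w)}).Reachable u z).card ≤
    (Finset.univ.filter fun T : SpanningTree n => T.1.Adj u v).card := by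
  rw [← Finset.card_sigma]
  let S : SpanningTree n → Fin n → SpanningTree n := fun T z =>
    if h : (T.1.deleteEdges {s(u, w)} ⊔ SimpleGraph.edge w z).IsTree then ⟨_, h⟩ else T
  have hS : ∀ (T : SpanningTree n) (z : Fin n), T.1.Adj u w →
      (T.1.deleteEdges {s(u, w)}).Reachable u z →
      (S T z).1 = T.1.deleteEdges {s(u, w)} ⊔ SimpleGraph.edge w z := by
    intro T z h hz
    simp only [S]
    rw [dif_pos (isTree_switch T.2 h hz)]
  refine Finset.card_le_card_of_injOn (fun e => S e.1 e.2) ?_ ?_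
  · rintro ⟨T, z⟩ h
    simp only [Finset.coe_sigma, Finset.coe_filter, Finset.mem_univ, true_and, Set.mem_sigma_iff,
      Set.mem_ofPred_eq] at h ⊢
    rw [hS T z h.1.2 h.2]
    refine Or.inl ?_
    simp only [SimpleGraph.deleteEdges_adj, Set.mem_singleton_iff, Sym2.eq_iff]
    refine ⟨h.1.1, ?_⟩
    rintro (⟨-, h'⟩ | ⟨rfl, rfl⟩)
    · exact hvw h'
    · exact hvw rfl
  · rintro ⟨T₁, z₁⟩ h₁ ⟨T₂, z₂⟩ h₂ h
    simp only [Finset.coe_sigma, Finset.coe_filter, Finset.mem_univ, true_and, Set.mem_sigma_iff,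
      Set.mem_ofPred_eq] at h₁ h₂ h
    have h' := congrArg Subtype.val h
    rw [hS _ _ h₁.1.2 h₁.2, hS _ _ h₂.1.2 h₂.2] at h'
    have n₁ := not_reachable_deleteEdges T₁.2 h₁.1.2
    have n₂ := not_reachable_deleteEdges T₂.2 h₂.1.2
    obtain rfl := eq_of_sup_edge_eq h' n₁ n₂ h₁.2
    have hD : T₁.1.deleteEdges {s(u, w)} = T₂.1.deleteEdges {s(u, w)} :=
      le_antisymm (le_of_sup_edge_eq h' n₁ h₁.2) (le_of_sup_edge_eq h'.symm n₂ h₂.2)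
    have hT : T₁ = T₂ := by
      apply Subtype.ext
      rw [← deleteEdges_sup_edge h₁.1.2, hD, deleteEdges_sup_edge h₂.1.2]
    rw [hT]

/-- A path from `u` starts with at most one of the edges `u v` and `u w`. -/
lemma reachable_deleteEdges_or (T : SpanningTree n) {u v w : Fin n} (hvw : v ≠ w) (z : Fin n) :
    (T.1.deleteEdges {s(u, w)}).Reachable u z ∨ (T.1.deleteEdges {s(u, v)}).Reachable u z := by
  obtain ⟨p, hp⟩ := (T.2.connected u z).exists_isPath
  simp only [SimpleGraph.reachable_deleteEdges_iff_exists_walk]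
  cases p with
  | nil => exact Or.inl ⟨.nil, by simp⟩
  | @cons _ a _ hadj q =>
    rw [SimpleGraph.Walk.cons_isPath_iff] at hp
    have key : ∀ x, x ≠ a → s(u, x) ∉ (SimpleGraph.Walk.cons hadj q).edges := by
      intro x hx hmem
      rw [SimpleGraph.Walk.edges_cons, List.mem_cons] at hmem
      rcases hmem with h | h
      · rw [Sym2.congr_right] at h
        exact hx h
      · exact hp.2 (SimpleGraph.Walk.fst_mem_support_of_mem_edges q h)
    by_cases ha : w = a
    · exact Or.inr ⟨_, key v (by rwa [← ha])⟩
    · exact Or.inl ⟨_, key w ha⟩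

/-- Two adjacent edges: for each of the trees containing both, the sides of `u` after removal of
one or the other edge cover all `n` vertices, so switching produces `n` trees containing one of the
two edges. -/
lemma treeProb_adj_adj_le (hn : 2 ≤ n) {u v w : Fin n} (huv : u ≠ v) (huw : u ≠ w) (hvw : v ≠ w) :
    treeProb (fun T : SpanningTree n => T.1.Adj u v ∧ T.1.Adj u w) ≤ 4 / (n : ℝ) ^ 2 := by
  classical
  have : NeZero n := ⟨by omega⟩
  have hN := card_spanningTree_pos (n := n)
  have hn0 : (0 : ℝ) < n := by exact_mod_cast (by omega : 0 < n)
  have h1 := sum_card_side_le (u := u) hvw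
  have h2 := sum_card_side_le (u := u) hvw.symm
  have hcomm : (Finset.univ.filter fun T : SpanningTree n => T.1.Adj u w ∧ T.1.Adj u v) =
      Finset.univ.filter fun T : SpanningTree n => T.1.Adj u v ∧ T.1.Adj u w :=
    Finset.filter_congr fun T _ => and_comm
  rw [hcomm] at h2
  have h3 : (Finset.univ.filter fun T : SpanningTree n => T.1.Adj u v ∧ T.1.Adj u w).card * n ≤
      (Finset.univ.filter fun T : SpanningTree n => T.1.Adj u v).card +
      (Finset.univ.filter fun T : SpanningTree n => T.1.Adj u w).card := by
    refine le_trans ?_ (add_le_add h1 h2)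
    rw [← Finset.sum_add_distrib, ← smul_eq_mul, ← Finset.sum_const]
    refine Finset.sum_le_sum fun T _ => ?_
    refine le_trans ?_ (Finset.card_union_le _ _)
    rw [← Finset.filter_or, Finset.filter_true_of_mem fun z _ => reachable_deleteEdges_or T hvw z]
    simp
  have h4 := treeProb_adj hn huv
  have h5 := treeProb_adj hn huw
  unfold treeProb at h4 h5 ⊢
  have h6 := add_le_add h4.le h5.le
  rw [← add_div, div_le_iff₀ hN] at h6
  rw [div_le_iff₀ hN]
  have h7 : ((Finset.univ.filter fun T : SpanningTree n => T.1.Adj u v ∧ T.1.Adj u w).card : ℝ) * n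
      ≤ (2 / n + 2 / n) * Fintype.card (SpanningTree n) := le_trans (by exact_mod_cast h3) h6
  rw [← le_div_iff₀ hn0] at h7
  have h8 : (2 / n + 2 / n) * (Fintype.card (SpanningTree n) : ℝ) / n =
      4 / (n : ℝ) ^ 2 * Fintype.card (SpanningTree n) := by
    field_simp
    ring
  rw [h8] at h7
  convert h7

/-- The second moment bound for a family of events, by the Cauchy-Schwarz inequality. -/
lemma sq_sum_treeProb_le [NeZero n] {ι : Type*} (I : Finset ι) (E : ι → SpanningTree n → Prop) :
    (∑ i ∈ I, treeProb (E i)) ^ 2 ≤ treeProb (fun T => ∃ i ∈ I, E i T) *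
      ∑ i ∈ I, ∑ j ∈ I, treeProb (fun T => E i T ∧ E j T) := by
  classical
  have hN := card_spanningTree_pos (n := n)
  set X : SpanningTree n → ℝ := fun T => ∑ i ∈ I, if E i T then 1 else 0 with hX
  have h1 : ∑ i ∈ I, treeProb (E i) = (∑ T, X T) / Fintype.card (SpanningTree n) := by
    simp only [treeProb_eq_sum, ← Finset.sum_div, hX]
    rw [Finset.sum_comm]
  have h2 : ∑ i ∈ I, ∑ j ∈ I, treeProb (fun T => E i T ∧ E j T) =
      (∑ T, X T ^ 2) / Fintype.card (SpanningTree n) := by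
    simp only [treeProb_eq_sum, ← Finset.sum_div, hX, pow_two, Finset.sum_mul_sum]
    congr 1
    rw [Finset.sum_comm (s := Finset.univ)]
    refine Finset.sum_congr rfl fun i _ => ?_
    rw [Finset.sum_comm]
    refine Finset.sum_congr rfl fun T _ => Finset.sum_congr rfl fun j _ => ?_
    by_cases hi : E i T <;> by_cases hj : E j T <;> simp [hi, hj]
  set Y : SpanningTree n → ℝ := fun T => if ∃ i ∈ I, E i T then 1 else 0 with hY
  have hXY : ∀ T, Y T * X T = X T := by
    intro T
    by_cases h : ∃ i ∈ I, E i T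
    · simp [hY, h]
    · push Not at h
      have : X T = 0 := Finset.sum_eq_zero fun i hi => by simp [h i hi]
      simp [this]
  have hYY : ∀ T, Y T ^ 2 = Y T := fun T => by simp only [hY]; split_ifs <;> simp
  have hCS := Finset.sum_mul_sq_le_sq_mul_sq Finset.univ Y X
  simp only [hXY, hYY] at hCS
  have h3 : treeProb (fun T => ∃ i ∈ I, E i T) = (∑ T, Y T) / Fintype.card (SpanningTree n) := by
    rw [treeProb_eq_sum]
    congr!
  rw [h1, h2, h3, div_pow, div_mul_div_comm, pow_two (Fintype.card _ : ℝ)]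
  exact div_le_div_of_nonneg_right hCS (by positivity)

end Correlation

/-! ### Hitting probabilities -/

section Hitting

variable {n : ℕ}

lemma treeProb_adj_disjoint_le' (hn : 8 ≤ n) {a b c d : Fin n} (hab : a ≠ b) (hac : a ≠ c)
    (had : a ≠ d) (hbc : b ≠ c) (hbd : b ≠ d) (hcd : c ≠ d) :
    treeProb (fun T : SpanningTree n => T.1.Adj a b ∧ T.1.Adj c d) ≤
      4 / (n : ℝ) ^ 2 * (1 + 8 / n) := by
  have : NeZero n := ⟨by omega⟩
  have h := treeProb_adj_disjoint_le hab hac had hbc hbd hcd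
  set p := treeProb (fun T : SpanningTree n => T.1.Adj a b ∧ T.1.Adj c d)
  obtain ⟨k, rfl⟩ : ∃ k, n = k + 8 := ⟨n - 8, by omega⟩
  have hd : (k + 8).descFactorial 4 = (k + 8) * (k + 7) * (k + 6) * (k + 5) := by
    simp [Nat.descFactorial]; ring
  rw [hd, show k + 8 - 1 = k + 7 by omega] at h
  push_cast at h ⊢
  have hk : (0 : ℝ) ≤ k := Nat.cast_nonneg k
  have h' : ((k : ℝ) + 8) * (k + 6) * (k + 5) * p ≤ 4 * (k + 7) := by
    have h7 : (0 : ℝ) < k + 7 := by positivity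
    refine le_of_mul_le_mul_right ?_ h7
    nlinarith
  have h0 : p ≤ 4 * (k + 7) / (((k : ℝ) + 8) * (k + 6) * (k + 5)) := by
    rw [le_div_iff₀ (by positivity)]; linarith
  refine h0.trans ?_
  have e : 4 / ((k : ℝ) + 8) ^ 2 * (1 + 8 / (k + 8)) = 4 * (k + 16) / ((k : ℝ) + 8) ^ 3 := by
    field_simp
    ring
  rw [e, div_le_div_iff₀ (by positivity) (by positivity)]
  have h2 : (k + 7) * ((k : ℝ) + 8) ^ 2 ≤ (k + 16) * ((k + 6) * (k + 5)) := by nlinarith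
  have := mul_le_mul_of_nonneg_left h2 (by positivity : (0 : ℝ) ≤ 4 * (k + 8))
  nlinarith

open Classical in
/-- The joint probability of two edges, with the correction for each possible coincidence. -/
lemma treeProb_pair_le (hn : 8 ≤ n) {e f : Fin n × Fin n} (he : e.1 ≠ e.2) (hf : f.1 ≠ f.2) :
    treeProb (fun T : SpanningTree n => T.1.Adj e.1 e.2 ∧ T.1.Adj f.1 f.2) ≤
      ((if f = e then 1 else 0) + if f = e.swap then 1 else 0) * (2 / (n : ℝ)) +
      ((if f.1 = e.1 then 1 else 0) + (if f.1 = e.2 then 1 else 0) +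
        (if f.2 = e.1 then 1 else 0) + if f.2 = e.2 then 1 else 0) * (4 / (n : ℝ) ^ 2) +
      4 / (n : ℝ) ^ 2 * (1 + 8 / n) := by
  obtain ⟨a, b⟩ := e
  obtain ⟨c, d⟩ := f
  simp only [Prod.swap_prod_mk, Prod.mk.injEq] at he hf ⊢
  have h2 : (0 : ℝ) ≤ 2 / n := by positivity
  have h3 : (0 : ℝ) ≤ 4 / (n : ℝ) ^ 2 := by positivity
  have h4 : (0 : ℝ) ≤ 4 / (n : ℝ) ^ 2 * (1 + 8 / n) := by positivity
  have hsingle : treeProb (fun T : SpanningTree n => T.1.Adj a b ∧ T.1.Adj c d) ≤ 2 / n :=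
    (treeProb_mono fun T h => h.1).trans (treeProb_adj (by omega) he).le
  have hadj : ∀ u v w : Fin n, u ≠ v → u ≠ w → v ≠ w →
      (∀ T : SpanningTree n, T.1.Adj a b ∧ T.1.Adj c d → T.1.Adj u v ∧ T.1.Adj u w) →
      treeProb (fun T : SpanningTree n => T.1.Adj a b ∧ T.1.Adj c d) ≤ 4 / (n : ℝ) ^ 2 :=
    fun u v w h1 h2 h3 h =>
      (treeProb_mono h).trans (treeProb_adj_adj_le (by omega) h1 h2 h3)
  by_cases hca : c = a
  · by_cases hdb : d = b
    · simp only [hca, hdb, he, he.symm, and_self, if_true, if_false] at hsingle ⊢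
      linarith
    · have := hadj a b d he (fun h => hf (hca.trans h)) (Ne.symm hdb)
        (fun T h => ⟨h.1, hca ▸ h.2⟩)
      have hda : d ≠ a := fun h => hf (hca.trans h.symm)
      simp only [hca, hdb, hda, he, and_false, if_true, if_false] at this ⊢
      linarith
  · by_cases hcb : c = b
    · by_cases hda : d = a
      · simp only [hcb, hda, he, he.symm, and_self, if_true, if_false] at hsingle ⊢
        linarith
      · have := hadj b a d he.symm (fun h => hf (hcb.trans h)) (Ne.symm hda)
          (fun T h => ⟨h.1.symm, hcb ▸ h.2⟩)
        have hdb : d ≠ b := fun h => hf (hcb.trans h.symm)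
        simp only [hcb, hda, hdb, he.symm, and_false, if_true, if_false] at this ⊢
        linarith
    · by_cases hda : d = a
      · have := hadj a b c he (fun h => hca h.symm) (fun h => hcb h.symm)
          (fun T h => ⟨h.1, hda ▸ h.2.symm⟩)
        simp only [hca, hcb, hda, he, and_self, if_true, if_false, false_and] at this ⊢
        linarith
      · by_cases hdb : d = b
        · have := hadj b a c he.symm (fun h => hcb h.symm) (fun h => hca h.symm)
            (fun T h => ⟨h.1.symm, hdb ▸ h.2.symm⟩)
          simp only [hca, hcb, hdb, he.symm, if_true, if_false, false_and] at this ⊢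
          linarith
        · have := treeProb_adj_disjoint_le' hn he (Ne.symm hca) (Ne.symm hda) (Ne.symm hcb)
            (Ne.symm hdb) hf
          simp only [hca, hcb, hda, hdb, if_false, false_and]
          linarith

/-- The expected waiting time for an edge inside a set of `m` vertices is at most this. -/
noncomputable def cliqueTime (n m : ℕ) : ℝ :=
  1 + n / (m * (m - 1)) + 12 / (m - 1)

/-- The second moment bound for the number of edges of the tree inside a set of vertices. -/
lemma one_le_treeProb_mul_cliqueTime (hn : 8 ≤ n) (U : Finset (Fin n)) (hU : 2 ≤ U.card) :
    1 ≤ treeProb (fun T : SpanningTree n => ∃ a ∈ U, ∃ b ∈ U, a ≠ b ∧ T.1.Adj a b) *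
      cliqueTime n U.card := by
  classical
  have : NeZero n := ⟨by omega⟩
  have hn0 : (0 : ℝ) < n := by exact_mod_cast (by omega : 0 < n)
  have hmn : (U.card : ℝ) ≤ n := by exact_mod_cast (Finset.card_le_univ U).trans_eq (by simp)
  set m := U.card with hm
  have hm2 : (2 : ℝ) ≤ m := by exact_mod_cast hU
  have hoff : ((U.offDiag.card : ℕ) : ℝ) = m * (m - 1) := by
    rw [Finset.offDiag_card, ← hm, Nat.cast_sub (Nat.le_mul_self m)]
    push_cast
    ring
  have hcs := sq_sum_treeProb_le (n := n) U.offDiag fun e T => T.1.Adj e.1 e.2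
  set p := treeProb (fun T : SpanningTree n => ∃ a ∈ U, ∃ b ∈ U, a ≠ b ∧ T.1.Adj a b) with hp
  have hpe : treeProb (fun T : SpanningTree n => ∃ e ∈ U.offDiag, T.1.Adj e.1 e.2) ≤ p := by
    refine treeProb_mono ?_
    rintro T ⟨e, he, hT⟩
    rw [Finset.mem_offDiag] at he
    exact ⟨e.1, he.1, e.2, he.2.1, he.2.2, hT⟩
  have h1 : ∑ e ∈ U.offDiag, treeProb (fun T : SpanningTree n => T.1.Adj e.1 e.2) =
      m * (m - 1) * (2 / n) := by
    rw [Finset.sum_congr rfl fun e he => treeProb_adj (by omega) (Finset.mem_offDiag.1 he).2.2,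
      Finset.sum_const, nsmul_eq_mul, hoff]
  have hfst : ∀ x : Fin n, ∑ f ∈ U.offDiag, (if f.1 = x then (1 : ℝ) else 0) ≤ m := by
    intro x
    refine (Finset.sum_le_sum_of_subset_of_nonneg (t := U ×ˢ U) ?_ ?_).trans ?_
    · exact fun e he => by simp at he ⊢; exact ⟨he.1, he.2.1⟩
    · intros; split_ifs <;> simp
    · rw [Finset.sum_product_right]
      simp only [Finset.sum_ite_eq', Finset.sum_const, nsmul_eq_mul, ← hm]
      split_ifs <;> simp
  have hsnd : ∀ x : Fin n, ∑ f ∈ U.offDiag, (if f.2 = x then (1 : ℝ) else 0) ≤ m := by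
    intro x
    refine (Finset.sum_le_sum_of_subset_of_nonneg (t := U ×ˢ U) ?_ ?_).trans ?_
    · exact fun e he => by simp at he ⊢; exact ⟨he.1, he.2.1⟩
    · intros; split_ifs <;> simp
    · rw [Finset.sum_product]
      simp only [Finset.sum_ite_eq', Finset.sum_const, nsmul_eq_mul, ← hm]
      split_ifs <;> simp
  have heq : ∀ x : Fin n × Fin n, ∑ f ∈ U.offDiag, (if f = x then (1 : ℝ) else 0) ≤ 1 := by
    intro x
    rw [Finset.sum_ite_eq']
    split_ifs <;> simp
  have h2 : ∑ e ∈ U.offDiag, ∑ f ∈ U.offDiag,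
      treeProb (fun T : SpanningTree n => T.1.Adj e.1 e.2 ∧ T.1.Adj f.1 f.2) ≤
      m * (m - 1) * (2 * (2 / n) + 4 * m * (4 / (n : ℝ) ^ 2) +
        m * (m - 1) * (4 / (n : ℝ) ^ 2 * (1 + 8 / n))) := by
    rw [← hoff, ← nsmul_eq_mul, ← Finset.sum_const]
    refine Finset.sum_le_sum fun e he => ?_
    refine (Finset.sum_le_sum fun f hf => treeProb_pair_le hn (Finset.mem_offDiag.1 he).2.2
      (Finset.mem_offDiag.1 hf).2.2).trans ?_
    rw [Finset.sum_add_distrib, Finset.sum_add_distrib, ← Finset.sum_mul, ← Finset.sum_mul,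
      Finset.sum_const, nsmul_eq_mul]
    simp only [Finset.sum_add_distrib]
    have h3 : (0 : ℝ) ≤ 4 / (n : ℝ) ^ 2 := by positivity
    gcongr
    · linarith [heq e, heq e.swap]
    · linarith [hfst e.1, hfst e.2, hsnd e.1, hsnd e.2]
  rw [h1] at hcs
  have hp0 : 0 ≤ p := treeProb_nonneg _
  have h3 : (m * (m - 1) * (2 / n) : ℝ) ^ 2 ≤ p * (m * (m - 1) * (2 * (2 / n) +
      4 * m * (4 / (n : ℝ) ^ 2) + m * (m - 1) * (4 / (n : ℝ) ^ 2 * (1 + 8 / n)))) := by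
    refine hcs.trans (mul_le_mul hpe h2 ?_ hp0)
    exact Finset.sum_nonneg fun _ _ => Finset.sum_nonneg fun _ _ => treeProb_nonneg _
  have hm1 : (0 : ℝ) < m - 1 := by linarith
  have hm0 : (0 : ℝ) < m := by linarith
  have h4 : (m * (m - 1) * (2 / n) : ℝ) ^ 2 * 1 ≤ (m * (m - 1) * (2 / n) : ℝ) ^ 2 *
      (p * (n / (m * (m - 1)) + 4 / (m - 1) + (1 + 8 / n))) := by
    rw [mul_one]
    refine h3.trans_eq ?_
    field_simp
    ring
  have h5 := le_of_mul_le_mul_left h4 (by positivity)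
  refine h5.trans (mul_le_mul_of_nonneg_left ?_ hp0)
  have h6 : (8 : ℝ) / n ≤ 8 / (m - 1) := by gcongr; linarith
  have h7 : (12 : ℝ) / (m - 1) = 4 / (m - 1) + 8 / (m - 1) := by ring
  rw [cliqueTime]
  linarith

/-- The second moment bound for the number of edges between a vertex and a set of vertices. -/
lemma div_le_treeProb_star (hn : 2 ≤ n) {c : Fin n} {S : Finset (Fin n)} (hc : c ∉ S) {k : ℕ}
    (hk : 0 < k) (hkS : k ≤ S.card) (hkn : 2 * k ≤ n) :
    (k : ℝ) / n ≤ treeProb (fun T : SpanningTree n => ∃ y ∈ S, T.1.Adj y c) := by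
  classical
  have : NeZero n := ⟨by omega⟩
  have hn0 : (0 : ℝ) < n := by exact_mod_cast (by omega : 0 < n)
  have hk0 : (0 : ℝ) < k := by exact_mod_cast hk
  obtain ⟨S', hS', hcard⟩ := Finset.exists_subset_card_eq hkS
  have hne : ∀ y ∈ S', c ≠ y := by
    rintro y hy rfl
    exact hc (hS' hy)
  refine le_trans ?_ (treeProb_mono (P := fun T : SpanningTree n => ∃ y ∈ S', T.1.Adj c y)
    fun T ⟨y, hy, h⟩ => ⟨y, hS' hy, h.symm⟩)
  have hcs := sq_sum_treeProb_le (n := n) S' fun y T => T.1.Adj c y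
  set p := treeProb (fun T : SpanningTree n => ∃ y ∈ S', T.1.Adj c y)
  have hp0 : 0 ≤ p := treeProb_nonneg _
  have h1 : ∑ y ∈ S', treeProb (fun T : SpanningTree n => T.1.Adj c y) = k * (2 / n) := by
    rw [Finset.sum_congr rfl fun y hy => treeProb_adj hn (hne y hy), Finset.sum_const,
      nsmul_eq_mul, hcard]
  have h2 : ∑ y ∈ S', ∑ z ∈ S', treeProb (fun T : SpanningTree n => T.1.Adj c y ∧ T.1.Adj c z) ≤
      k * (2 / n + k * (4 / (n : ℝ) ^ 2)) := by
    rw [← hcard, ← nsmul_eq_mul, ← Finset.sum_const]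
    refine Finset.sum_le_sum fun y hy => ?_
    calc ∑ z ∈ S', treeProb (fun T : SpanningTree n => T.1.Adj c y ∧ T.1.Adj c z)
        ≤ ∑ z ∈ S', ((if z = y then 2 / (n : ℝ) else 0) + 4 / (n : ℝ) ^ 2) := by
          refine Finset.sum_le_sum fun z hz => ?_
          have h3 : (0 : ℝ) ≤ 4 / (n : ℝ) ^ 2 := by positivity
          by_cases h : z = y
          · rw [if_pos h]
            have := (treeProb_mono fun (T : SpanningTree n) (h : T.1.Adj c y ∧ T.1.Adj c z) =>
              h.1).trans (treeProb_adj hn (hne y hy)).le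
            linarith
          · rw [if_neg h, zero_add]
            exact treeProb_adj_adj_le hn (hne y hy) (hne z hz) (Ne.symm h)
      _ = 2 / n + S'.card * (4 / (n : ℝ) ^ 2) := by
          rw [Finset.sum_add_distrib, Finset.sum_ite_eq', if_pos hy, Finset.sum_const,
            nsmul_eq_mul]
  rw [h1] at hcs
  have h3 := hcs.trans (mul_le_mul_of_nonneg_left h2 hp0)
  have hkn' : 2 * (k : ℝ) ≤ n := by exact_mod_cast hkn
  have h4 : k * (2 / n + k * (4 / (n : ℝ) ^ 2)) ≤ k * (4 / (n : ℝ)) := by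
    have h5 : k * (4 / (n : ℝ) ^ 2) ≤ 2 / n := by
      rw [pow_two, ← mul_div_assoc, div_le_div_iff₀ (by positivity) hn0]
      nlinarith
    have h6 : (4 : ℝ) / n = 2 / n + 2 / n := by ring
    rw [h6]
    gcongr
  have h7 := h3.trans (mul_le_mul_of_nonneg_left h4 hp0)
  have h8 : k * (4 / (n : ℝ)) * (k / n) ≤ k * (4 / (n : ℝ)) * p := by
    calc k * (4 / (n : ℝ)) * (k / n) = (k * (2 / n)) ^ 2 := by ring
      _ ≤ _ := h7
      _ = _ := by ring
  exact le_of_mul_le_mul_left h8 (by positivity)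

lemma one_le_treeProb_add_sum [NeZero n] {ι : Type*} (I : Finset ι) {Q : SpanningTree n → Prop}
    {E : ι → SpanningTree n → Prop} (h : ∀ T, Q T ∨ ∃ i ∈ I, E i T) :
    1 ≤ treeProb Q + ∑ i ∈ I, treeProb (E i) := by
  classical
  have hN := card_spanningTree_pos (n := n)
  simp only [treeProb_eq_sum]
  rw [← Finset.sum_div, ← add_div, Finset.sum_comm, ← Finset.sum_add_distrib, le_div_iff₀ hN,
    one_mul, Fintype.card_eq_sum_ones, Nat.cast_sum]
  refine Finset.sum_le_sum fun T _ => ?_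
  rw [Nat.cast_one]
  have h0 : ∀ i ∈ I, (0 : ℝ) ≤ if E i T then 1 else 0 := fun i _ => by split_ifs <;> simp
  rcases h T with hQ | ⟨i, hi, hE⟩
  · rw [if_pos hQ]
    linarith [Finset.sum_nonneg h0]
  · have h1 := Finset.single_le_sum h0 hi
    rw [if_pos hE] at h1
    have h2 : (0 : ℝ) ≤ if Q T then 1 else 0 := by split_ifs <;> simp
    linarith

/-- A vertex of the tree has a neighbour, which avoids a small set with probability at least
one half. -/
lemma half_le_treeProb_escape (hn : 2 ≤ n) (d : Fin n) {B : Finset (Fin n)}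
    (hB : 4 * B.card ≤ n) :
    1 / 2 ≤ treeProb (fun T : SpanningTree n => ∃ x ∉ B, T.1.Adj x d) := by
  have : NeZero n := ⟨by omega⟩
  have : Nontrivial (Fin n) := Fin.nontrivial_iff_two_le.2 hn
  have hn0 : (0 : ℝ) < n := by exact_mod_cast (by omega : 0 < n)
  have h1 : (1 : ℝ) ≤ treeProb (fun T : SpanningTree n => ∃ x ∉ B, T.1.Adj x d) +
      ∑ x ∈ B, treeProb (fun T : SpanningTree n => T.1.Adj x d) := by
    refine one_le_treeProb_add_sum B fun T => ?_
    obtain ⟨x, hx⟩ := T.2.connected.preconnected.exists_adj_of_nontrivial d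
    by_cases hxB : x ∈ B
    · exact Or.inr ⟨x, hxB, hx.symm⟩
    · exact Or.inl ⟨x, hxB, hx.symm⟩
  have h2 : ∑ x ∈ B, treeProb (fun T : SpanningTree n => T.1.Adj x d) ≤ B.card * (2 / n) := by
    rw [← nsmul_eq_mul, ← Finset.sum_const]
    refine Finset.sum_le_sum fun x _ => ?_
    by_cases hxd : x = d
    · simp only [hxd, SimpleGraph.irrefl, treeProb, Finset.filter_false, Finset.card_empty]
      simp
      positivity
    · exact (treeProb_adj hn hxd).le
  have h3 : (B.card : ℝ) * (2 / n) ≤ 1 / 2 := by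
    have : 4 * (B.card : ℝ) ≤ n := by exact_mod_cast hB
    rw [← mul_div_assoc, div_le_iff₀ hn0]
    linarith
  linarith

end Hitting

/-! ### The greedy strategy and its potential -/

section Strategy

variable {n : ℕ}

/-- Some edge of the offered tree lowers the deficiency. -/
def Lowers (F : SimpleGraph (Fin n)) (T : SpanningTree n) : Prop :=
  ∃ e ∈ T.1.edgeSet, deficiency (addEdge F e) < deficiency F

/-- Some edge of the offered tree raises the reach, the deficiency being unchanged. -/
def Raises (F : SimpleGraph (Fin n)) (T : SpanningTree n) : Prop :=
  ∃ e ∈ T.1.edgeSet, deficiency (addEdge F e) = deficiency F ∧ reach F < reach (addEdge F e)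

lemma exists_mem_edgeSet (hn : 2 ≤ n) (T : SpanningTree n) : ∃ e, e ∈ T.1.edgeSet := by
  have : Nontrivial (Fin n) := Fin.nontrivial_iff_two_le.2 hn
  obtain ⟨x, hx⟩ := T.2.connected.preconnected.exists_adj_of_nontrivial ⟨0, by omega⟩
  exact ⟨s(_, x), hx⟩

open Classical in
/-- The greedy strategy: lower the deficiency if possible, otherwise raise the reach if possible,
otherwise take any edge of the tree. -/
noncomputable def greedy (hn : 2 ≤ n) : Strategy n where
  choose F T :=
    if h : Lowers F T then h.choose
    else if h : Raises F T then h.choose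
    else (exists_mem_edgeSet hn T).choose
  choose_mem F T := by
    split_ifs with h₁ h₂
    · exact h₁.choose_spec.1
    · exact h₂.choose_spec.1
    · exact (exists_mem_edgeSet hn T).choose_spec

/-- The graph after one round of the greedy strategy. -/
noncomputable def greedyStep (hn : 2 ≤ n) (F : SimpleGraph (Fin n)) (T : SpanningTree n) :
    SimpleGraph (Fin n) :=
  addEdge F ((greedy hn).choose F T)

lemma le_greedyStep (hn : 2 ≤ n) (F : SimpleGraph (Fin n)) (T : SpanningTree n) :
    F ≤ greedyStep hn F T := le_addEdge _ _

lemma deficiency_greedyStep_lt (hn : 2 ≤ n) {F : SimpleGraph (Fin n)} {T : SpanningTree n}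
    (h : Lowers F T) : deficiency (greedyStep hn F T) < deficiency F := by
  simp only [greedyStep, greedy, dif_pos h]
  exact h.choose_spec.2

lemma lt_reach_greedyStep (hn : 2 ≤ n) {F : SimpleGraph (Fin n)} {T : SpanningTree n}
    (h₁ : ¬ Lowers F T) (h : Raises F T) : reach F < reach (greedyStep hn F T) := by
  simp only [greedyStep, greedy, dif_neg h₁, dif_pos h]
  exact h.choose_spec.2.2

end Strategy

section Potential

variable {n : ℕ}

/-- A bound for the expected time that is spent at deficiency `j`: below the threshold `M`, time
`2 k` to raise the reach to `k` and then time `n / k` to hit a target. -/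
noncomputable def levelCost (n k M j : ℕ) : ℝ :=
  if j ≤ M then 2 * k + n / k else cliqueTime n j

/-- A bound for the expected time until the deficiency of `F` is lowered. -/
noncomputable def phaseCost (k M : ℕ) (F : SimpleGraph (Fin n)) : ℝ :=
  if deficiency F ≤ M then 2 * (k - min (reach F) k : ℕ) + n / k
  else cliqueTime n (deficiency F)

/-- A bound for the expected time until `F` becomes Hamiltonian. -/
noncomputable def potential (k M : ℕ) (F : SimpleGraph (Fin n)) : ℝ :=
  if deficiency F = 0 then 0
  else ∑ j ∈ Finset.range (deficiency F - 1), levelCost n k M (j + 1) + phaseCost k M F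

/-- The amount by which the potential falls in a successful round. -/
noncomputable def gain (k M : ℕ) (F : SimpleGraph (Fin n)) : ℝ :=
  if deficiency F ≤ M then (if k ≤ reach F then n / k else 2) else cliqueTime n (deficiency F)

lemma one_le_cliqueTime {m : ℕ} (hm : 2 ≤ m) : 1 ≤ cliqueTime n m := by
  have : (2 : ℝ) ≤ m := by exact_mod_cast hm
  have h1 : (0 : ℝ) ≤ n / (m * (m - 1)) := by
    apply div_nonneg (Nat.cast_nonneg _)
    nlinarith
  have h2 : (0 : ℝ) ≤ 12 / (m - 1) := div_nonneg (by norm_num) (by linarith)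
  rw [cliqueTime]
  linarith

lemma levelCost_nonneg {k M j : ℕ} (hM : 1 ≤ M) : 0 ≤ levelCost n k M j := by
  unfold levelCost
  split_ifs with h
  · positivity
  · exact zero_le_one.trans (one_le_cliqueTime (by omega))

lemma phaseCost_le_levelCost (k M : ℕ) (F : SimpleGraph (Fin n)) :
    phaseCost k M F ≤ levelCost n k M (deficiency F) := by
  unfold phaseCost levelCost
  split_ifs with h
  · gcongr
    exact Nat.sub_le _ _
  · exact le_rfl

lemma gain_le_phaseCost (k M : ℕ) (F : SimpleGraph (Fin n)) :
    gain k M F ≤ phaseCost k M F := by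
  unfold gain phaseCost
  split_ifs with h₁ h₂
  · simp
  · have : (1 : ℝ) ≤ (k - min (reach F) k : ℕ) := by
      exact_mod_cast (by omega : 1 ≤ k - min (reach F) k)
    have h3 : (0 : ℝ) ≤ n / k := by positivity
    linarith
  · exact le_rfl

lemma gain_nonneg {k M : ℕ} (hM : 1 ≤ M) (F : SimpleGraph (Fin n)) : 0 ≤ gain k M F := by
  unfold gain
  split_ifs with h₁ h₂
  · positivity
  · norm_num
  · exact zero_le_one.trans (one_le_cliqueTime (by omega))

lemma potential_le_sum {k M : ℕ} (F : SimpleGraph (Fin n)) :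
    potential k M F ≤ ∑ j ∈ Finset.range (deficiency F), levelCost n k M (j + 1) := by
  unfold potential
  split_ifs with h
  · simp [h]
  · obtain ⟨m, hm⟩ := Nat.exists_eq_succ_of_ne_zero h
    have := phaseCost_le_levelCost k M F
    rw [hm] at this ⊢
    rw [Finset.sum_range_succ]
    simp only [Nat.succ_eq_add_one, Nat.add_sub_cancel] at this ⊢
    linarith

lemma potential_nonneg {k M : ℕ} (hM : 1 ≤ M) (F : SimpleGraph (Fin n)) :
    0 ≤ potential k M F := by
  unfold potential
  split_ifs with h
  · exact le_rfl
  · exact add_nonneg (Finset.sum_nonneg fun j _ => levelCost_nonneg hM)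
      ((gain_nonneg hM F).trans (gain_le_phaseCost k M F))

lemma potential_le_of_deficiency_lt {k M : ℕ} (hM : 1 ≤ M) {F F' : SimpleGraph (Fin n)}
    (h : deficiency F' < deficiency F) : potential k M F' ≤ potential k M F - gain k M F := by
  have h1 : potential k M F' ≤ ∑ j ∈ Finset.range (deficiency F - 1), levelCost n k M (j + 1) := by
    refine (potential_le_sum F').trans ?_
    exact Finset.sum_le_sum_of_subset_of_nonneg (Finset.range_subset_range.2 (by omega))
      fun _ _ _ => levelCost_nonneg hM
  have h2 := gain_le_phaseCost k M F
  have h3 : potential k M F = ∑ j ∈ Finset.range (deficiency F - 1), levelCost n k M (j + 1) +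
      phaseCost k M F := if_neg (by omega)
  linarith

lemma phaseCost_anti {k M : ℕ} {F F' : SimpleGraph (Fin n)} (hd : deficiency F' = deficiency F)
    (hr : reach F ≤ reach F') : phaseCost k M F' ≤ phaseCost k M F := by
  unfold phaseCost
  rw [hd]
  split_ifs with h
  · have : ((k - min (reach F') k : ℕ) : ℝ) ≤ (k - min (reach F) k : ℕ) := by
      exact_mod_cast (by omega)
    linarith
  · exact le_rfl

lemma potential_anti {k M : ℕ} (hM : 1 ≤ M) (hn : 2 ≤ n) {F F' : SimpleGraph (Fin n)}
    (h : F ≤ F') : potential k M F' ≤ potential k M F := by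
  have : NeZero n := ⟨by omega⟩
  rcases (deficiency_anti h).lt_or_eq with hlt | heq
  · linarith [potential_le_of_deficiency_lt (k := k) hM hlt, gain_nonneg (k := k) hM F]
  · have := phaseCost_anti (k := k) (M := M) heq (reach_mono h heq)
    unfold potential
    rw [heq]
    split_ifs
    · exact le_rfl
    · linarith

lemma potential_le_of_reach_lt {k M : ℕ} {F F' : SimpleGraph (Fin n)}
    (hd : deficiency F' = deficiency F) (h0 : deficiency F ≠ 0) (hdM : deficiency F ≤ M)
    (hr : reach F < reach F') (hk : reach F < k) :
    potential k M F' ≤ potential k M F - gain k M F := by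
  have h1 : (((k - min (reach F') k : ℕ) : ℝ) + 1) ≤ (k - min (reach F) k : ℕ) := by
    exact_mod_cast (by omega)
  unfold potential phaseCost gain
  rw [hd, if_neg h0, if_neg h0, if_pos hdM, if_pos hdM, if_pos hdM, if_neg (by omega)]
  linarith

/-- A round is successful if the greedy strategy is certain to lower the potential. -/
def Success (k M : ℕ) (F : SimpleGraph (Fin n)) (T : SpanningTree n) : Prop :=
  Lowers F T ∨ (deficiency F ≤ M ∧ reach F < k ∧ Raises F T)

open Classical in
lemma potential_greedyStep_le {k M : ℕ} (hM : 1 ≤ M) (hn : 2 ≤ n) {F : SimpleGraph (Fin n)}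
    (h0 : deficiency F ≠ 0) (T : SpanningTree n) :
    potential k M (greedyStep hn F T) ≤
      potential k M F - (if Success k M F T then 1 else 0) * gain k M F := by
  have : NeZero n := ⟨by omega⟩
  split_ifs with h
  · rw [one_mul]
    by_cases hL : Lowers F T
    · exact potential_le_of_deficiency_lt hM (deficiency_greedyStep_lt hn hL)
    · obtain ⟨hdM, hk, hR⟩ := h.resolve_left hL
      rcases (deficiency_anti (le_greedyStep hn F T)).lt_or_eq with hlt | heq
      · exact potential_le_of_deficiency_lt hM hlt
      · exact potential_le_of_reach_lt heq h0 hdM (lt_reach_greedyStep hn hL hR) hk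
  · rw [zero_mul, sub_zero]
    exact potential_anti hM hn (le_greedyStep hn F T)

/-- In every state, the expected gain of a round is at least one. -/
lemma one_le_treeProb_success_mul_gain {k M : ℕ} (hM : 1 ≤ M) (hn : 8 ≤ n) (hk : 0 < k)
    (hkn : 4 * k ≤ n) {F : SimpleGraph (Fin n)} (h0 : deficiency F ≠ 0) :
    1 ≤ treeProb (Success k M F) * gain k M F := by
  have : NeZero n := ⟨by omega⟩
  have : Nontrivial (Fin n) := Fin.nontrivial_iff_two_le.2 (by omega)
  have hn0 : (0 : ℝ) < n := by exact_mod_cast (by omega : 0 < n)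
  have hk0 : (0 : ℝ) < k := by exact_mod_cast hk
  have hg := gain_nonneg (k := k) hM F
  by_cases hdM : deficiency F ≤ M
  · by_cases hr : k ≤ reach F
    · obtain ⟨c, hc, hcard⟩ := exists_isEnd_card_targets h0
      have hcS : c ∉ targets F c := by
        rw [mem_targets]
        simp [addEdge]
      have h1 := div_le_treeProb_star (by omega) hcS hk (hcard ▸ hr) (by omega)
      have h2 : treeProb (fun T : SpanningTree n => ∃ y ∈ targets F c, T.1.Adj y c) ≤
          treeProb (Success k M F) :=
        treeProb_mono fun T ⟨y, hy, hT⟩ => Or.inl ⟨s(y, c), hT, mem_targets.1 hy⟩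
      have h3 := mul_le_mul_of_nonneg_right (h1.trans h2) hg
      refine le_trans (le_of_eq ?_) h3
      rw [gain, if_pos hdM, if_pos hr]
      field_simp
    · obtain ⟨c, hc, hcard⟩ := exists_isEnd_card_targets h0
      obtain ⟨d, B, hB, hext⟩ := hc.exists_extend
      have h1 := half_le_treeProb_escape (n := n) (by omega) d (B := B) (by omega)
      have h2 : treeProb (fun T : SpanningTree n => ∃ x ∉ B, T.1.Adj x d) ≤
          treeProb (Success k M F) := by
        refine treeProb_mono fun T ⟨x, hx, hT⟩ => ?_
        rcases hext x hx hT.ne with h | h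
        · exact Or.inl ⟨s(x, d), hT, h⟩
        · exact Or.inr ⟨hdM, by omega, s(x, d), hT, h.1, hcard ▸ h.2⟩
      have h3 := mul_le_mul_of_nonneg_right (h1.trans h2) hg
      refine le_trans (le_of_eq ?_) h3
      rw [gain, if_pos hdM, if_neg hr]
      norm_num
  · obtain ⟨U, hU, hlow⟩ := exists_finset_deficiency_lt F
    have h1 := one_le_treeProb_mul_cliqueTime hn U (by omega)
    have h2 : treeProb (fun T : SpanningTree n => ∃ a ∈ U, ∃ b ∈ U, a ≠ b ∧ T.1.Adj a b) ≤
        treeProb (Success k M F) :=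
      treeProb_mono fun T ⟨a, ha, b, hb, hab, hT⟩ =>
        Or.inl ⟨s(a, b), hT, hlow a ha b hb hab⟩
    rw [hU] at h1
    rw [gain, if_neg hdM] at hg ⊢
    exact h1.trans (mul_le_mul_of_nonneg_right h2 hg)

/-- The potential falls by at least one per round, on average. -/
lemma avg_potential_greedyStep_le {k M : ℕ} (hM : 1 ≤ M) (hn : 8 ≤ n) (hk : 0 < k)
    (hkn : 4 * k ≤ n) {F : SimpleGraph (Fin n)} (h0 : deficiency F ≠ 0) :
    (∑ T, potential k M (greedyStep (by omega) F T)) / Fintype.card (SpanningTree n) ≤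
      potential k M F - 1 := by
  classical
  have : NeZero n := ⟨by omega⟩
  have hN := card_spanningTree_pos (n := n)
  have h1 := one_le_treeProb_success_mul_gain (M := M) hM hn hk hkn h0
  rw [treeProb_eq_sum, div_mul_eq_mul_div, le_div_iff₀ hN, Finset.sum_mul] at h1
  rw [div_le_iff₀ hN]
  refine (Finset.sum_le_sum fun T _ =>
    potential_greedyStep_le (k := k) hM (by omega : 2 ≤ n) h0 T).trans ?_
  rw [Finset.sum_sub_distrib, Finset.sum_const, nsmul_eq_mul, Finset.card_univ]
  linarith

end Potential

/-! ### The process of offered trees -/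

section Rounds

variable {n : ℕ}

lemma graphAfter_congr (σ : Strategy n) {T T' : ℕ → SpanningTree n} {t : ℕ}
    (h : ∀ i < t, T i = T' i) : graphAfter σ T t = graphAfter σ T' t := by
  induction t with
  | zero => rfl
  | succ t ih =>
    simp only [graphAfter]
    rw [ih fun i hi => h i (by omega), h t (by omega)]

lemma graphAfter_succ (σ : Strategy n) (T : ℕ → SpanningTree n) (t : ℕ) :
    graphAfter σ T (t + 1) = addEdge (graphAfter σ T t) (σ.choose (graphAfter σ T t) (T t)) :=
  rfl

lemma ncard_edgeSet_addEdge_le (F : SimpleGraph (Fin n)) (e : Sym2 (Fin n)) :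
    (addEdge F e).edgeSet.ncard ≤ F.edgeSet.ncard + 1 := by
  refine (Set.ncard_le_ncard ?_ (Set.toFinite _)).trans (Set.ncard_insert_le e F.edgeSet)
  intro f hf
  simp only [addEdge, SimpleGraph.edgeSet_sup, SimpleGraph.edgeSet_fromEdgeSet, Set.mem_union,
    Set.mem_sdiff, Set.mem_singleton_iff] at hf
  exact hf.elim Or.inr fun h => Or.inl h.1

lemma ncard_edgeSet_graphAfter_le (σ : Strategy n) (T : ℕ → SpanningTree n) (t : ℕ) :
    (graphAfter σ T t).edgeSet.ncard ≤ t := by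
  induction t with
  | zero => simp [graphAfter]
  | succ t ih =>
    rw [graphAfter_succ]
    exact (ncard_edgeSet_addEdge_le _ _).trans (by omega)

/-- A Hamiltonian graph has at least `n` edges. -/
lemma le_ncard_edgeSet (hn : 3 ≤ n) {F : SimpleGraph (Fin n)} (h : deficiency F = 0) :
    n ≤ F.edgeSet.ncard := by
  obtain ⟨v, p, hp⟩ := exists_isHamiltonianCycle (by simpa using hn) h
  have h1 : p.edges.toFinset.card = n := by
    rw [List.toFinset_card_of_nodup hp.isCycle.edges_nodup, SimpleGraph.Walk.length_edges,
      hp.length_eq, Fintype.card_fin]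
  refine h1.symm.le.trans ?_
  rw [← Set.ncard_coe_finset]
  refine Set.ncard_le_ncard (fun e he => ?_) (Set.toFinite _)
  exact p.edges_subset_edgeSet (by simpa using he)

instance : MeasurableSpace (SimpleGraph (Fin n)) := ⊤

instance : DiscreteMeasurableSpace (SimpleGraph (Fin n)) := ⟨fun _ => trivial⟩

lemma measurable_graphAfter (σ : Strategy n) (t : ℕ) :
    Measurable fun T : ℕ → SpanningTree n => graphAfter σ T t := by
  induction t with
  | zero => exact measurable_const
  | succ t ih =>
    have h : Measurable fun q : SimpleGraph (Fin n) × SpanningTree n =>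
        addEdge q.1 (σ.choose q.1 q.2) := .of_discrete
    exact h.comp (ih.prodMk (measurable_pi_apply t))

lemma integral_uniformOn_univ (f : SpanningTree n → ℝ) :
    ∫ T, f T ∂ProbabilityTheory.uniformOn (Set.univ : Set (SpanningTree n)) =
      (∑ T, f T) / Fintype.card (SpanningTree n) := by
  rw [integral_fintype .of_finite, Finset.sum_div]
  refine Finset.sum_congr rfl fun T _ => ?_
  rw [measureReal_def, ProbabilityTheory.uniformOn_univ]
  simp [div_eq_inv_mul]

variable [NeZero n]

instance : IsProbabilityMeasure (treeLaw n) := by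
  unfold treeLaw; infer_instance

/-- The graph after `t` rounds is independent of the tree offered in the next round. -/
lemma indepFun_graphAfter (σ : Strategy n) (t : ℕ) :
    ProbabilityTheory.IndepFun (fun T : ℕ → SpanningTree n => graphAfter σ T t) (fun T => T t)
      (treeLaw n) := by
  have hind : ProbabilityTheory.iIndepFun (fun (i : ℕ) (T : ℕ → SpanningTree n) => T i)
      (treeLaw n) :=
    ProbabilityTheory.iIndepFun_infinitePi (X := fun _ T => T) fun _ => measurable_id
  have h := hind.indepFun_finset (Finset.range t) {t} (by simp) fun i => measurable_pi_apply i
  let ext : (Finset.range t → SpanningTree n) → ℕ → SpanningTree n := fun r i =>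
    if h : i ∈ Finset.range t then r ⟨i, h⟩ else Classical.arbitrary _
  have h' := h.comp (φ := fun r => graphAfter σ (ext r) t)
    (ψ := fun r : ({t} : Finset ℕ) → SpanningTree n => r ⟨t, Finset.mem_singleton_self t⟩)
    .of_discrete .of_discrete
  refine h'.congr (.of_forall fun T => ?_) (.of_forall fun T => rfl)
  refine graphAfter_congr σ fun i hi => ?_
  simp [ext, hi]

lemma map_eval_treeLaw (t : ℕ) : (treeLaw n).map (fun T => T t) =
    ProbabilityTheory.uniformOn (Set.univ : Set (SpanningTree n)) :=
  Measure.infinitePi_map_eval _ t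

/-- The Markov property: conditionally on the first `t` rounds, the tree offered in the next round
is uniform. -/
lemma integral_graphAfter_succ (σ : Strategy n) (h : SimpleGraph (Fin n) → ℝ) (t : ℕ) :
    ∫ T, h (graphAfter σ T (t + 1)) ∂treeLaw n =
      ∫ T, (∑ T', h (addEdge (graphAfter σ T t) (σ.choose (graphAfter σ T t) T'))) /
        Fintype.card (SpanningTree n) ∂treeLaw n := by
  have hm := measurable_graphAfter σ t
  have hmt : Measurable fun T : ℕ → SpanningTree n => T t := measurable_pi_apply t
  have hprod := (ProbabilityTheory.indepFun_iff_map_prod_eq_prod_map_map hm.aemeasurable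
    hmt.aemeasurable).1 (indepFun_graphAfter σ t)
  have := Measure.isProbabilityMeasure_map (μ := treeLaw n) hm.aemeasurable
  set g : SimpleGraph (Fin n) × SpanningTree n → ℝ := fun q =>
    h (addEdge q.1 (σ.choose q.1 q.2)) with hg
  calc ∫ T, h (graphAfter σ T (t + 1)) ∂treeLaw n
      = ∫ q, g q ∂(treeLaw n).map fun T => (graphAfter σ T t, T t) := by
        rw [integral_map (hm.prodMk hmt).aemeasurable
          (Measurable.of_discrete (f := g)).aestronglyMeasurable]
        rfl
    _ = ∫ F, ∫ T', g (F, T') ∂ProbabilityTheory.uniformOn Set.univ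
          ∂(treeLaw n).map fun T => graphAfter σ T t := by
        rw [hprod, map_eval_treeLaw, integral_prod _ .of_finite]
    _ = _ := by
        rw [integral_map hm.aemeasurable
          (Measurable.of_discrete (f := fun F => ∫ T', g (F, T')
            ∂ProbabilityTheory.uniformOn Set.univ)).aestronglyMeasurable]
        simp only [integral_uniformOn_univ, hg]

/-- The time accounted for after `t` rounds: `n` once the graph is Hamiltonian, and before that the
elapsed time plus the expected remaining time. -/
noncomputable def account (k M t : ℕ) (F : SimpleGraph (Fin n)) : ℝ :=
  if deficiency F = 0 then n else potential k M F + t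

lemma account_graphAfter_succ_le {k M : ℕ} (hM : 1 ≤ M) (hn : 8 ≤ n) (hk : 0 < k)
    (hkn : 4 * k ≤ n) {t : ℕ} {F : SimpleGraph (Fin n)} (hF : F.edgeSet.ncard ≤ t) :
    (∑ T', account k M (t + 1) (greedyStep (by omega) F T')) / Fintype.card (SpanningTree n) ≤
      account k M t F := by
  have hN := card_spanningTree_pos (n := n)
  by_cases h0 : deficiency F = 0
  · have h1 : ∀ T', account k M (t + 1) (greedyStep (by omega) F T') = n := fun T' =>
      if_pos (Nat.le_zero.1 (h0 ▸ deficiency_anti (le_greedyStep (by omega) F T')))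
    rw [account, if_pos h0, Finset.sum_congr rfl fun T' _ => h1 T', div_le_iff₀ hN,
      Finset.sum_const, nsmul_eq_mul, Finset.card_univ, mul_comm]
  · have h1 : ∀ T', account k M (t + 1) (greedyStep (by omega) F T') ≤
        potential k M (greedyStep (by omega) F T') + (t + 1) := by
      intro T'
      unfold account
      split_ifs with h
      · -- a Hamiltonian cycle needs `n` rounds
        have h2 := (le_ncard_edgeSet (by omega) h).trans (ncard_edgeSet_addEdge_le F _)
        have h3 : (n : ℝ) ≤ t + 1 := by exact_mod_cast h2.trans (by omega)
        linarith [potential_nonneg (k := k) hM (greedyStep (by omega) F T')]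
      · push_cast
        exact le_rfl
    have h2 := avg_potential_greedyStep_le (M := M) hM hn hk hkn h0
    rw [div_le_iff₀ hN] at h2 ⊢
    refine (Finset.sum_le_sum fun T' _ => h1 T').trans ?_
    rw [account, if_neg h0, Finset.sum_add_distrib, Finset.sum_const, nsmul_eq_mul,
      Finset.card_univ]
    linarith

lemma integrable_graphAfter (σ : Strategy n) (h : SimpleGraph (Fin n) → ℝ) (t : ℕ) :
    Integrable (fun T => h (graphAfter σ T t)) (treeLaw n) := by
  have hm := measurable_graphAfter σ t
  have := Measure.isProbabilityMeasure_map (μ := treeLaw n) hm.aemeasurable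
  exact (Integrable.of_finite (μ := (treeLaw n).map fun T => graphAfter σ T t)
    (f := h)).comp_measurable hm

lemma integral_account_le {k M : ℕ} (hM : 1 ≤ M) (hn : 8 ≤ n) (hk : 0 < k)
    (hkn : 4 * k ≤ n) (t : ℕ) :
    ∫ T, account k M t (graphAfter (greedy (by omega)) T t) ∂treeLaw n ≤
      account k M 0 (⊥ : SimpleGraph (Fin n)) := by
  induction t with
  | zero => simp [graphAfter]
  | succ t ih =>
    refine le_trans ?_ ih
    rw [integral_graphAfter_succ]
    refine integral_mono (integrable_graphAfter _ (fun F => (∑ T', account k M (t + 1)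
      (addEdge F ((greedy (by omega)).choose F T'))) / Fintype.card (SpanningTree n)) t)
      (integrable_graphAfter _ (account k M t) t) fun T => ?_
    exact account_graphAfter_succ_le hM hn hk hkn (ncard_edgeSet_graphAfter_le _ T t)

/-- Markov's inequality for the time spent beyond `n`. -/
lemma measureReal_deficiency_ne_zero_mul_le {k M : ℕ} (hM : 1 ≤ M) (hn : 8 ≤ n) (hk : 0 < k)
    (hkn : 4 * k ≤ n) (t : ℕ) :
    (treeLaw n).real {T | deficiency (graphAfter (greedy (by omega)) T t) ≠ 0} * (t - n) ≤
      ∑ j ∈ Finset.range n, levelCost n k M (j + 1) - n := by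
  have hdef : deficiency (⊥ : SimpleGraph (Fin n)) ≤ n := by
    simpa using deficiency_le_card (⊥ : SimpleGraph (Fin n))
  have hbot : deficiency (⊥ : SimpleGraph (Fin n)) ≠ 0 := by
    intro h
    have := le_ncard_edgeSet (by omega) h
    simp at this
    omega
  have h1 := integral_account_le (M := M) hM hn hk hkn t
  have h2 : account k M 0 (⊥ : SimpleGraph (Fin n)) ≤
      ∑ j ∈ Finset.range n, levelCost n k M (j + 1) := by
    rw [account, if_neg hbot, Nat.cast_zero, add_zero]
    refine (potential_le_sum _).trans ?_
    exact Finset.sum_le_sum_of_subset_of_nonneg (Finset.range_subset_range.2 hdef)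
      fun _ _ _ => levelCost_nonneg hM
  set A := {T | deficiency (graphAfter (greedy (by omega : 2 ≤ n)) T t) ≠ 0} with hA
  have hAm : MeasurableSet A :=
    measurable_graphAfter _ t (MeasurableSet.of_discrete (s := {F | deficiency F ≠ 0}))
  have h3 : ∫ T, ((n : ℝ) + A.indicator (fun _ => (t - n : ℝ)) T) ∂treeLaw n ≤
      ∫ T, account k M t (graphAfter (greedy (by omega)) T t) ∂treeLaw n := by
    refine integral_mono ((integrable_const _).add ((integrable_const _).indicator hAm))
      (integrable_graphAfter _ (account k M t) t) fun T => ?_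
    simp only [account]
    by_cases h : deficiency (graphAfter (greedy (by omega : 2 ≤ n)) T t) = 0
    · rw [if_pos h, Set.indicator_of_notMem (by simpa [hA] using h), add_zero]
    · rw [if_neg h, Set.indicator_of_mem (by simpa [hA] using h)]
      linarith [potential_nonneg (k := k) hM (graphAfter (greedy (by omega : 2 ≤ n)) T t)]
  rw [integral_add (integrable_const _) ((integrable_const _).indicator hAm),
    integral_indicator_const _ hAm] at h3
  simp only [integral_const, probReal_univ, smul_eq_mul] at h3
  linarith

end Rounds

/-! ### Choice of parameters and convergence -/

section Asymptotics

lemma sum_levelCost_le {n k M N : ℕ} (hM : 1 ≤ M) (hN : M ≤ N) :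
    ∑ j ∈ Finset.range N, levelCost n k M (j + 1) ≤
      M * (2 * k + n / k) + N * (1 + 12 / M) + (n / M - n / N) := by
  have hM0 : (0 : ℝ) < M := by exact_mod_cast hM
  induction N, hN using Nat.le_induction with
  | base =>
    have h1 : ∑ j ∈ Finset.range M, levelCost n k M (j + 1) = M * (2 * k + n / k) := by
      have h : ∀ j ∈ Finset.range M, levelCost n k M (j + 1) = 2 * k + n / k :=
        fun j hj => if_pos (Finset.mem_range.1 hj)
      rw [Finset.sum_congr rfl h, Finset.sum_const, nsmul_eq_mul, Finset.card_range]
    have h2 : (0 : ℝ) ≤ M * (1 + 12 / M) := by positivity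
    linarith
  | succ N hN ih =>
    have hN0 : (0 : ℝ) < N := by exact_mod_cast (by omega : 0 < N)
    have hMN : (M : ℝ) ≤ N := by exact_mod_cast hN
    have h1 : levelCost n k M (N + 1) = 1 + (n / N - n / (N + 1)) + 12 / N := by
      rw [levelCost, if_neg (by omega), cliqueTime]
      push_cast
      rw [add_sub_cancel_right]
      congr 2
      field_simp
      ring
    have h2 : (12 : ℝ) / N ≤ 12 / M := by gcongr
    rw [Finset.sum_range_succ, h1]
    push_cast
    linarith

/-- The choice of `k` close to `n ^ (1 / 2)` and of `M` close to `n ^ (1 / 4)` balances the costs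
of the two phases. -/
lemma exists_sum_levelCost_le {n : ℕ} (hn : 25 ≤ n) : ∃ k M : ℕ, 1 ≤ M ∧ 0 < k ∧ 4 * k ≤ n ∧
    ∑ j ∈ Finset.range n, levelCost n k M (j + 1) - n ≤ 23 * (n : ℝ) ^ (3 / 4 : ℝ) := by
  have hn0 : (0 : ℝ) ≤ n := Nat.cast_nonneg n
  have hn25 : (25 : ℝ) ≤ n := by exact_mod_cast hn
  set a : ℝ := (n : ℝ) ^ (1 / 4 : ℝ) with ha
  have ha4 : a ^ 4 = n := by
    rw [ha, ← Real.rpow_natCast, ← Real.rpow_mul hn0]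
    norm_num
  have ha3 : (n : ℝ) ^ (3 / 4 : ℝ) = a ^ 3 := by
    rw [ha, ← Real.rpow_natCast, ← Real.rpow_mul hn0]
    norm_num
  have ha0 : 0 ≤ a := by positivity
  have ha2 : 5 ≤ a ^ 2 := by nlinarith [sq_nonneg (a ^ 2)]
  have ha1 : 1 ≤ a := by nlinarith
  have hM := Nat.le_ceil a
  have hM' := (Nat.ceil_lt_add_one ha0).le
  have hk := Nat.le_ceil (a ^ 2)
  have hk' := (Nat.ceil_lt_add_one (sq_nonneg a)).le
  refine ⟨⌈a ^ 2⌉₊, ⌈a⌉₊, Nat.one_le_ceil_iff.2 (by linarith), Nat.ceil_pos.2 (by linarith),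
    ?_, ?_⟩
  · have : (4 * ⌈a ^ 2⌉₊ : ℝ) ≤ n := by nlinarith
    exact_mod_cast this
  · have hMn : ⌈a⌉₊ ≤ n := Nat.ceil_le.2 (by nlinarith)
    have h1 := sum_levelCost_le (n := n) (k := ⌈a ^ 2⌉₊)
      (Nat.one_le_ceil_iff.2 (by linarith)) hMn
    set K : ℝ := (⌈a ^ 2⌉₊ : ℝ)
    set m : ℝ := (⌈a⌉₊ : ℝ)
    have hK0 : 0 < K := by linarith
    have hm0 : 0 < m := by linarith
    have h2 : (n : ℝ) / K ≤ a ^ 2 := by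
      rw [div_le_iff₀ hK0, ← ha4]
      nlinarith
    have h3 : (n : ℝ) / m ≤ a ^ 3 := by
      rw [div_le_iff₀ hm0, ← ha4]
      have := mul_le_mul_of_nonneg_left hM (pow_nonneg ha0 3)
      linarith
    have h4 : m * (2 * K + n / K) ≤ 2 * a * (5 * a ^ 2) :=
      mul_le_mul (by linarith) (by linarith) (by positivity) (by positivity)
    have h5 : (n : ℝ) * (1 + 12 / m) = n + 12 * (n / m) := by ring
    have h6 : (0 : ℝ) ≤ (n : ℝ) / n := by positivity
    rw [ha3]
    linarith

variable {n : ℕ}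

lemma deficiency_ne_zero_prob_le [NeZero n] (hn : 25 ≤ n) {w : ℝ} (hw : 2 ≤ w) :
    (treeLaw n).real {T | deficiency (graphAfter (greedy (by omega)) T
      ⌊n + w * (n : ℝ) ^ (3 / 4 : ℝ)⌋₊) ≠ 0} ≤ 46 / w := by
  obtain ⟨k, M, hM, hk, hkn, hsum⟩ := exists_sum_levelCost_le hn
  have h1 := measureReal_deficiency_ne_zero_mul_le hM (by omega : 8 ≤ n) hk hkn
    ⌊n + w * (n : ℝ) ^ (3 / 4 : ℝ)⌋₊
  have hb : (1 : ℝ) ≤ (n : ℝ) ^ (3 / 4 : ℝ) :=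
    Real.one_le_rpow (by exact_mod_cast (by omega : 1 ≤ n)) (by norm_num)
  set b := (n : ℝ) ^ (3 / 4 : ℝ)
  have hfl := Nat.lt_floor_add_one (n + w * b)
  set t := ⌊n + w * b⌋₊
  set p := (treeLaw n).real {T | deficiency (graphAfter (greedy (by omega : 2 ≤ n)) T t) ≠ 0}
  have hp : 0 ≤ p := measureReal_nonneg
  have h2 : w * b / 2 ≤ t - n := by nlinarith
  have h3 : p * (w * b / 2) ≤ 23 * b := (mul_le_mul_of_nonneg_left h2 hp).trans (h1.trans hsum)
  rw [le_div_iff₀ (by linarith)]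
  have hb0 : 0 < b := by linarith
  refine le_of_mul_le_mul_right ?_ hb0
  linarith

lemma exists_hittingTime_eq {σ : Strategy n} {P : Set (SimpleGraph (Fin n))}
    {T : ℕ → SpanningTree n} {t : ℕ} (h : graphAfter σ T t ∈ P) :
    ∃ s : ℕ, hittingTime σ P T = (s : ℕ∞) ∧ s ≤ t := by
  have hle : hittingTime σ P T ≤ t := iInf₂_le (f := fun (i : ℕ) _ => (i : ℕ∞)) t h
  obtain ⟨s, hs⟩ := ENat.ne_top_iff_exists.1 (ne_top_of_le_ne_top (ENat.natCast_ne_top t) hle)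
  exact ⟨s, hs.symm, by rw [← hs] at hle; exact_mod_cast hle⟩

/-- The greedy strategy builds a Hamiltonian cycle in time with probability at least
`1 - 46 / w`. -/
lemma one_sub_le_treeLaw_hittingTime [NeZero n] (hn : 25 ≤ n) {w : ℝ} (hw : 2 ≤ w) :
    1 - ENNReal.ofReal (46 / w) ≤ treeLaw n {T | ∃ t : ℕ,
      hittingTime (greedy (by omega : 2 ≤ n)) (hamiltonianCycleProperty n) T = (t : ℕ∞) ∧
        (t : ℝ) ≤ n + w * (n : ℝ) ^ (3 / 4 : ℝ)} := by
  have h1 := deficiency_ne_zero_prob_le hn hw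
  set t := ⌊n + w * (n : ℝ) ^ (3 / 4 : ℝ)⌋₊ with ht
  set A := {T | deficiency (graphAfter (greedy (by omega : 2 ≤ n)) T t) ≠ 0} with hA
  have hAm : MeasurableSet A :=
    measurable_graphAfter _ t (MeasurableSet.of_discrete (s := {F | deficiency F ≠ 0}))
  have h2 : treeLaw n A ≤ ENNReal.ofReal (46 / w) := by
    rw [← ofReal_measureReal]
    exact ENNReal.ofReal_le_ofReal h1
  calc 1 - ENNReal.ofReal (46 / w) ≤ 1 - treeLaw n A := tsub_le_tsub_left h2 1
    _ = treeLaw n Aᶜ := (prob_compl_eq_one_sub hAm).symm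
    _ ≤ _ := measure_mono fun T hT => ?_
  have hT0 : deficiency (graphAfter (greedy (by omega : 2 ≤ n)) T t) = 0 := by
    simpa [hA] using hT
  have hmem : graphAfter (greedy (by omega : 2 ≤ n)) T t ∈ hamiltonianCycleProperty n := by
    obtain ⟨v, p, hp⟩ := exists_isHamiltonianCycle (by rw [Fintype.card_fin]; omega) hT0
    refine ⟨v, p, ?_⟩
    convert hp
  obtain ⟨s, hs, hst⟩ := exists_hittingTime_eq hmem
  refine ⟨s, hs, ?_⟩
  have h3 : (s : ℝ) ≤ t := by exact_mod_cast hst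
  exact h3.trans (Nat.floor_le (by positivity))

end Asymptotics

end USTSR

theorem mainTheorem3 (ω : ℕ → ℝ) (hω : Tendsto ω atTop atTop) :
    ∃ σ : (n : Set.Ici (2 : ℕ)) → USTSR.Strategy n,
      Tendsto
        (fun n : Set.Ici (2 : ℕ) =>
          USTSR.treeLaw n
            {T | ∃ t : ℕ,
              USTSR.hittingTime (σ n) (USTSR.hamiltonianCycleProperty n) T = (t : ℕ∞) ∧
                (t : ℝ) ≤ (n : ℕ) + ω n * ((n : ℕ) : ℝ) ^ (3 / 4 : ℝ)})
        atTop (𝓝 1) := by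
  refine ⟨fun n => USTSR.greedy n.2, ?_⟩
  have hω' : Tendsto (fun n : Set.Ici (2 : ℕ) => ω n) atTop atTop :=
    tendsto_comp_val_Ici_atTop.2 hω
  have hn' : Tendsto (fun n : Set.Ici (2 : ℕ) => (n : ℕ)) atTop atTop :=
    tendsto_comp_val_Ici_atTop (f := fun n : ℕ => n).2 tendsto_id
  have hlim : Tendsto (fun n : Set.Ici (2 : ℕ) => 1 - ENNReal.ofReal (46 / ω n)) atTop (𝓝 1) := by
    have h1 : Tendsto (fun n : Set.Ici (2 : ℕ) => ENNReal.ofReal (46 / ω n)) atTop (𝓝 0) := by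
      simpa using ENNReal.tendsto_ofReal (hω'.const_div_atTop 46)
    simpa using ENNReal.Tendsto.sub tendsto_const_nhds h1 (Or.inl ENNReal.one_ne_top)
  refine tendsto_of_tendsto_of_tendsto_of_le_of_le' hlim tendsto_const_nhds ?_
    (.of_forall fun n => prob_le_one)
  filter_upwards [hω'.eventually_ge_atTop 2, hn'.eventually_ge_atTop 25] with n hw hn
  exact USTSR.one_sub_le_treeLaw_hittingTime hn hw
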